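/- There are absolute constants $C$ and $K$ such that for every $\varepsilon \in (0, 1/2]$ there is a randomized online quantile summary in the cash register (insertion-only) and comparison model with the following two properties, for every totally ordered domain $\mathcal{D}$ and every fixed stream $x_1, x_2, \ldots$ of items of $\mathcal{D}$. Write $X_t = x_1 \ldots x_t$. (Model.) After each arrival the memory of the summary consists of stored stream items and of integer words. When an item arrives, the summary updates its memory using only its integer words, the outcomes of comparisons between the stored items and the new item, and fresh random choices. The length of the stream is not known in advance. A query is answered by a stored item, chosen from the integer words, the comparisons between the stored items, and the query rank. Every stored item and every integer word counts as one word of memory; at time $t$ an integer word holds a number that is at most $(t+2)^K$, i.e. $O(\log t)$ bits. 1. (Space.) Deterministically, that is, for all outcomes of the random choices and at all times, the summary uses at most $C \cdot \frac{1}{\varepsilon} \log \frac{1}{\varepsilon}$ words. 2. (Accuracy.) For every time $t$ and every query rank $\rho \in (0, t]$ for which some integer $k \in \{1, \ldots, t\}$ has $|k - \rho| \le \varepsilon t$ (this holds for every $\rho \in \{1, \ldots, t\}$, and for every real $\rho \in (0, t]$ as soon as $\varepsilon t \ge 1$), the summary, queried at time $t$ with $\rho$, returns with probability at least $1 - e^{-1/\varepsilon}$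 an item $y$ of $X_t$ such that $|\mathrm{rank}(y, X_t) - \rho| \le \varepsilon t$. Here $\mathrm{rank}(y, X_t)$ is the number of items of $X_t$ that are $\le y$, if the items of $X_t$ are distinct. If items repeat, the copies of $y$ occupy the consecutive ranks $\#\{i \le t : x_i < y\} + 1, \ldots, \#\{i \le t : x_i \le y\}$, and the inequality is required for one of them. -/

import Mathlib

noncomputable section

namespace QuantileSummary

universe u

/-- The memory contents of a streaming algorithm in the comparison model: a list of stored stream
items, and a list of integer words (counters, list lengths, flags and so on). -/
structure Config (D : Type u) where
  items : List D
  mem : List ℕ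

/-- Memory usage in words: an item costs one word and an integer word costs one word.
(The size of the integers is restricted separately, see `UsesSpace`.) -/
def Config.words {D : Type u} (c : Config D) : ℕ :=
  c.items.length + c.mem.length

/-- All that a comparison-based algorithm may learn about a list of items of a totally ordered
domain: the outcomes of the comparisons between its entries. -/
def comparisons {D : Type u} [LinearOrder D] (w : List D) :
    Fin w.length → Fin w.length → Bool :=
  fun i j => decide (w.get i ≤ w.get j)

/-- A randomized online summary in the cash register (insertion only) and comparison model.
It does not depend on the domain of the items.

* `init` is the initial content of the integer words; no item is stored at the beginning.
* `update` is called when an item arrives. It sees the integer words, and the comparisons between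
  the `n` currently available items (the stored ones followed by the new one). It chooses, with
  fresh randomness, the list of the positions of the items that are stored from now on, and the
  new integer words. Nothing else is carried over to the next time step: neither the time nor
  past random choices nor discarded items.
* `query` answers a rank query: it sees the integer words, the comparisons between the stored
  items and the query rank, and it returns the position of a stored item (or nothing). -/
structure ComparisonSummary where
  init : List ℕ
  update : List ℕ → (n : ℕ) → (Fin n → Fin n → Bool) → PMF (List (Fin n) × List ℕ)
  query : List ℕ → (n : ℕ) → (Fin n → Fin n → Bool) → ℝ → Option (Fin n)

namespace ComparisonSummary

variable {D : Type u} [LinearOrder D]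

/-- Processing of one arriving item `a` in the configuration `c`. -/
def step (A : ComparisonSummary) (c : Config D) (a : D) : PMF (Config D) :=
  let w := c.items ++ [a]
  (A.update c.mem w.length (comparisons w)).map fun p => ⟨p.1.map w.get, p.2⟩

/-- The distribution of the configuration after the first `t` items `x 0, …, x (t - 1)` of the
stream `x` have been processed. -/
def run (A : ComparisonSummary) (x : ℕ → D) : ℕ → PMF (Config D)
  | 0 => PMF.pure ⟨[], A.init⟩
  | t + 1 => (A.run x t).bind fun c => A.step c (x t)

/-- The item that is returned in the configuration `c` for the query rank `ρ`. -/
def answer (A : ComparisonSummary) (c : Config D) (ρ : ℝ) : Option D :=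
  (A.query c.mem c.items.length (comparisons c.items) ρ).map c.items.get

/-- On the stream `x`, in every possible random outcome and at all times, the summary occupies at
most `S` words, where an integer word at time `t` holds a number that is at most `(t + 2) ^ K`
(a word has `O(log t)` bits). -/
def UsesSpace (A : ComparisonSummary) (x : ℕ → D) (S : ℝ) (K : ℕ) : Prop :=
  ∀ t : ℕ, ∀ c ∈ (A.run x t).support, (c.words : ℝ) ≤ S ∧ ∀ n ∈ c.mem, n ≤ (t + 2) ^ K

end ComparisonSummary

/-- The rank of `y` among the first `t` items of the stream `x`: the number of items `≤ y`. -/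
def rank {D : Type u} [LinearOrder D] (y : D) (x : ℕ → D) (t : ℕ) : ℕ :=
  ((Finset.range t).filter fun i => x i ≤ y).card

/-- The number of items `< y` among the first `t` items of the stream `x`. -/
def strictRank {D : Type u} [LinearOrder D] (y : D) (x : ℕ → D) (t : ℕ) : ℕ :=
  ((Finset.range t).filter fun i => x i < y).card

/-- The item `y` occurs among the first `t` items of `x`, and its rank there is within `δ` of `ρ`.
The copies of an item that arrives several times occupy the consecutive ranks
`strictRank y x t + 1, …, rank y x t`, and one of them has to be within `δ` of `ρ`. If the items
are distinct, the only such rank is `rank y x t` (`rankWithin_iff` below). -/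
def RankWithin {D : Type u} [LinearOrder D] (y : D) (x : ℕ → D) (t : ℕ) (ρ δ : ℝ) : Prop :=
  ∃ k : ℕ, strictRank y x t < k ∧ k ≤ rank y x t ∧ |(k : ℝ) - ρ| ≤ δ

/-- For distinct items, `RankWithin` is the plain inequality `|rank y - ρ| ≤ δ`. -/
theorem rankWithin_iff {D : Type u} [LinearOrder D] {x : ℕ → D} {t : ℕ}
    (hx : Set.InjOn x (Set.Iio t)) (y : D) (ρ δ : ℝ) :
    RankWithin y x t ρ δ ↔ (∃ i < t, x i = y) ∧ |(rank y x t : ℝ) - ρ| ≤ δ := by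
  have key : rank y x t =
      strictRank y x t + ((Finset.range t).filter fun i => x i = y).card := by
    unfold rank strictRank
    rw [← Finset.card_union_of_disjoint]
    · congr 1
      ext i
      simp only [Finset.mem_filter, Finset.mem_union, Finset.mem_range, le_iff_lt_or_eq]
      tauto
    · rw [Finset.disjoint_filter]
      intro i _ h1 h2
      exact h1.ne h2
  have hle : ((Finset.range t).filter fun i => x i = y).card ≤ 1 := by
    rw [Finset.card_le_one]
    intro a ha b hb
    simp only [Finset.mem_filter, Finset.mem_range] at ha hb
    exact hx ha.1 hb.1 (ha.2.trans hb.2.symm)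
  constructor
  · rintro ⟨k, h1, h2, h3⟩
    have hk : k = rank y x t := by omega
    have hpos : 0 < ((Finset.range t).filter fun i => x i = y).card := by omega
    obtain ⟨i, hi⟩ := Finset.card_pos.mp hpos
    simp only [Finset.mem_filter, Finset.mem_range] at hi
    exact ⟨⟨i, hi.1, hi.2⟩, hk ▸ h3⟩
  · rintro ⟨⟨i, hi, hy⟩, h⟩
    have hpos : 0 < ((Finset.range t).filter fun i => x i = y).card :=
      Finset.card_pos.mpr ⟨i, by simp [hi, hy]⟩
    exact ⟨rank y x t, by omega, le_rfl, h⟩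

/-- The probability that the summary, queried at time `t` with the rank `ρ`, returns an item whose
rank among the first `t` items of `x` is within `δ` of `ρ`. -/
def successProb {D : Type u} [LinearOrder D] (A : ComparisonSummary) (x : ℕ → D) (t : ℕ)
    (ρ δ : ℝ) : ENNReal :=
  (A.run x t).toOuterMeasure {c | ∃ y, A.answer c ρ = some y ∧ RankWithin y x t ρ δ}

end QuantileSummary

end

/-!
The summary samples the stream and feeds the sample into a deterministic summary in the manner of
Greenwald and Khanna.

*Sampling.* The stream is cut into blocks of length about `ε³ t / 64` (a power of two, and `1` at
the beginning), and one uniformly chosen item of each block is inserted with the length of the block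
as its weight. For a fixed set of at most `t` positions the error of the sampled weight is a sum of
independent centred variables, and by Chernoff's bound (`sampleError_tail`) it exceeds `ε t / 2`
with probability at most `e ^ (-3 / ε)`. A wrong answer implies such an error for the set of the
items of too small rank or for the set of the items whose rank is not too large
(`rankWithin_or_sampleError`). Ties are broken by the time of arrival.

*The deterministic summary.* Each stored item carries a lower and an upper bound on the weight of
the sampled items that precede it. A new item takes its bounds from its two neighbours. A run of
stored items may be dropped if the uncertainty that this leaves between its two neighbours is at
most `ε t / 4`, and if no dropped item is in an older age class than one of these neighbours. The
ages at which the classes end grow geometrically, and the cuts between classes are hierarchical: a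
cut at a later time was a cut all the time since.

*Space.* When no drop is possible, each age class has `O(1 / ε)` members. Let `u`, `v` be adjacent
among the stored items that are older than the class. At some time `s` within the class the gap
between `u` and `v` was within the tolerance of that time with nothing stored in between
(`Inv.cut`). As the gap exceeds the present tolerance, items of weight proportional to `ε (t - s)`
have arrived in it since. Moreover the lower bounds of alternate members of the class between `u`
and `v` differ by a similar amount, for which only items of the class or younger ones account
(`Inv.young`). So the members are paid for by the items that arrived since the beginning of the
class (`Inv.bandCount_mul_le`), whose weight is proportional to the age of the class. The classes
younger than a block contain a bounded number of samples, and the number of the other classes is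
`O(log (1 / ε))`, since the blocks have relative length `ε³ / 64` (`Inv.length_le`).
-/

noncomputable section

namespace QuantileSummary

/-! ### The deterministic weighted summary -/

/-- A stored item: `b` is its position in the stream, and `lo` and `hi` are a lower and an upper
bound on the total weight of the sampled items that precede it. -/
structure Node where
  b : ℕ
  lo : ℕ
  hi : ℕ

/-- The effect on a node of an item of weight `d` that is inserted before it. -/
def Node.shift (d : ℕ) (v : Node) : Node := ⟨v.b, v.lo + d, v.hi + d⟩

@[simp] theorem Node.shift_b (d : ℕ) (v : Node) : (v.shift d).b = v.b := rfl
@[simp] theorem Node.shift_lo (d : ℕ) (v : Node) : (v.shift d).lo = v.lo + d := rfl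
@[simp] theorem Node.shift_hi (d : ℕ) (v : Node) : (v.shift d).hi = v.hi + d := rfl

/-- Lower bound on the weight of the sampled items up to and including the last node of `pre`. -/
def lowEnd (w : ℕ → ℕ) (pre : List Node) : ℕ := (pre.getLast?).elim 0 fun u => u.lo + w u.b

/-- Upper bound on the weight of the sampled items before the first node of `post`; `W` is the
total weight of the sampled items. -/
def highEnd (W : ℕ) (post : List Node) : ℕ := (post.head?).elim W Node.hi

/-- The times `T ≤ t` at which the past of `t` is cut into age classes: those that lie within
`2 ^ (k + 1)` of `t` for a power `2 ^ k` that divides `T`. The ages of the cuts grow geometrically,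
and a cut of a later time is a cut of every earlier time since. -/
def IsCut (t T : ℕ) : Prop := T ≤ t ∧ ∃ k, 2 ^ k ∣ T ∧ t < T + 2 ^ (k + 1)

/-- The nodes next to the gap between `pre` and `post` (if any) are older than `T`. -/
def OlderEnds (T : ℕ) (pre post : List Node) : Prop :=
  (∀ p ∈ pre.getLast?, p.b < T) ∧ ∀ j ∈ post.head?, j.b < T

/-- A run of nodes may be dropped if the gap that it leaves is within the tolerance `E t` and if
no node of the run belongs to an older age class than one of the two nodes next to it. -/
def Drop (w E : ℕ → ℕ) (t W : ℕ) (L L' : List Node) : Prop :=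
  ∃ pre mid post, mid ≠ [] ∧ L = pre ++ (mid ++ post) ∧ L' = pre ++ post ∧
    highEnd W post ≤ lowEnd w pre + E t ∧
    ∀ T, IsCut t T → (∃ z ∈ mid, z.b < T) → OlderEnds T pre post

/-- The total weight of the sampled items that arrived at time `T` or later and lie after all
nodes of `pre` and before all nodes of `post`. Here `y` is the stream. -/
def mass {α : Type*} [LinearOrder α] (w : ℕ → ℕ) (y : ℕ → α) (S : Finset ℕ) (T : ℕ)
    (pre post : List Node) : ℕ :=
  ∑ q ∈ S with (T ≤ q ∧ (∀ u ∈ pre, y u.b < y q) ∧ ∀ v ∈ post, y q < y v.b), w q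

/-- The weight of the sampled items before the item `b`. -/
def below {α : Type*} [LinearOrder α] (w : ℕ → ℕ) (y : ℕ → α) (S : Finset ℕ) (b : ℕ) : ℕ :=
  ∑ q ∈ S with y q < y b, w q

/-- The invariant of the summary at time `t`, where `S` is the set of the sampled positions of the
stream `y` and `W` their total weight. The field `cut` says that the gap between two nodes that
are adjacent among those older than a cut `T` was within the tolerance at some time `s` since `T`
at which no node was stored between them. The field `young` says that the lower bound of a younger
node accounts, beyond that of the preceding older node, for items younger than `T` only. -/
structure Inv {α : Type*} [LinearOrder α] (w E : ℕ → ℕ) (y : ℕ → α) (t : ℕ) (S : Finset ℕ)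
    (W : ℕ) (L : List Node) : Prop where
  sorted : L.Pairwise fun u v => y u.b < y v.b
  sub : ∀ v ∈ L, v.b ∈ S
  lt : ∀ q ∈ S, q < t
  total : W = ∑ q ∈ S, w q
  mono : L.Pairwise fun u v => u.lo + w u.b ≤ v.lo
  delta : ∀ v ∈ L, v.hi ≤ v.lo + E v.b
  rank_lo : ∀ v ∈ L, v.lo ≤ below w y S v.b
  rank_hi : ∀ v ∈ L, below w y S v.b ≤ v.hi
  gap : ∀ pre post, L = pre ++ post → highEnd W post ≤ lowEnd w pre + E t
  cut : ∀ T, IsCut t T → ∀ pre mid post, L = pre ++ (mid ++ post) → (∀ z ∈ mid, T ≤ z.b) →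
    OlderEnds T pre post → ∃ s, T ≤ s ∧ s ≤ t ∧ (∀ z ∈ mid, s ≤ z.b) ∧
      highEnd W post ≤ lowEnd w pre + E s + mass w y S s pre post
  young : ∀ T, IsCut t T → ∀ pre mid d post, L = pre ++ (mid ++ d :: post) →
    (∀ z ∈ mid, T ≤ z.b) → T ≤ d.b → (∀ p ∈ pre.getLast?, p.b < T) →
      d.lo ≤ lowEnd w pre + mass w y S T pre (d :: post)

theorem IsCut.mono {t s T : ℕ} (h : IsCut t T) (h1 : T ≤ s) (h2 : s ≤ t) : IsCut s T :=
  ⟨h1, h.2.imp fun _ hk => ⟨hk.1, by omega⟩⟩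

/-- The junction of one decomposition of a list lies in the left, the right or the middle part of
a second decomposition. -/
theorem append_eq_append_three {β : Type*} {p j pre mid post : List β}
    (h : p ++ j = pre ++ (mid ++ post)) :
    (∃ c, c ≠ [] ∧ pre = p ++ c ∧ j = c ++ (mid ++ post)) ∨
    (∃ c, c ≠ [] ∧ post = c ++ j ∧ p = pre ++ (mid ++ c)) ∨
    ∃ m1 m2, mid = m1 ++ m2 ∧ p = pre ++ m1 ∧ j = m2 ++ post := by
  rcases List.append_eq_append_iff.mp h with ⟨a, h1, h2⟩ | ⟨a, h1, h2⟩
  · by_cases ha : a = []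
    · subst ha
      exact .inr (.inr ⟨[], mid, by simp_all⟩)
    · exact .inl ⟨a, ha, h1, h2⟩
  · rcases List.append_eq_append_iff.mp h2 with ⟨c, h3, h4⟩ | ⟨c, h3, h4⟩
    · by_cases hc : c = []
      · subst hc
        exact .inr (.inr ⟨mid, [], by simp_all⟩)
      · exact .inr (.inl ⟨c, hc, h4, by rw [h1, h3]⟩)
    · exact .inr (.inr ⟨a, c, h3, h1, h4⟩)

theorem lowEnd_append {w : ℕ → ℕ} {p c : List Node} (hc : c ≠ []) :
    lowEnd w (p ++ c) = lowEnd w c := by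
  simp [lowEnd, List.getLast?_append_of_ne_nil _ hc]

theorem highEnd_append {W : ℕ} {p c : List Node} (hc : c ≠ []) :
    highEnd W (c ++ p) = highEnd W c := by
  simp [highEnd, List.head?_append_of_ne_nil _ hc]

theorem highEnd_congr {W : ℕ} (W' : ℕ) {c : List Node} (hc : c ≠ []) :
    highEnd W c = highEnd W' c := by
  cases c <;> simp_all [highEnd]

theorem lowEnd_append_cons {w : ℕ → ℕ} (p : List Node) (x : Node) {c : List Node} (hc : c ≠ []) :
    lowEnd w (p ++ x :: c) = lowEnd w c := by
  rw [List.append_cons, lowEnd_append hc]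

theorem lowEnd_le {w : ℕ → ℕ} {l : List Node} {n : ℕ} (h : ∀ u ∈ l, u.lo + w u.b ≤ n) :
    lowEnd w l ≤ n := by
  rcases List.eq_nil_or_concat' l with rfl | ⟨l, a, rfl⟩
  · simp [lowEnd]
  · simpa [lowEnd] using h a (by simp)

theorem le_lowEnd {w : ℕ → ℕ} {l : List Node} (h : l.Pairwise fun u v => u.lo + w u.b ≤ v.lo) :
    ∀ u ∈ l, u.lo + w u.b ≤ lowEnd w l := by
  rcases List.eq_nil_or_concat' l with rfl | ⟨l, a, rfl⟩
  · simp
  · intro u hu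
    simp only [List.pairwise_append, List.mem_append, List.mem_singleton] at h hu
    simp only [lowEnd, List.getLast?_concat, Option.elim_some]
    rcases hu with hu | rfl
    · exact (h.2.2 u hu a rfl).trans (Nat.le_add_right _ _)
    · rfl

theorem highEnd_map_shift (W d : ℕ) (l : List Node) :
    highEnd (W + d) (l.map (Node.shift d)) = highEnd W l + d := by
  cases l <;> simp [highEnd]

theorem lowEnd_map_shift {w : ℕ → ℕ} (d : ℕ) {l : List Node} (hl : l ≠ []) :
    lowEnd w (l.map (Node.shift d)) = lowEnd w l + d := by
  obtain ⟨l', a, rfl⟩ := List.eq_nil_or_concat' l |>.resolve_left hl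
  simp [lowEnd]
  omega

theorem lowEnd_concat {w : ℕ → ℕ} (l : List Node) (a : Node) :
    lowEnd w (l ++ [a]) = a.lo + w a.b := by
  simp [lowEnd]

section mass

variable {α : Type*} [LinearOrder α] {w : ℕ → ℕ} {y : ℕ → α}

theorem mass_le_mass {S S' : Finset ℕ} {T T' : ℕ} {pre pre' post post' : List Node}
    (h : ∀ q ∈ S, T ≤ q → (∀ u ∈ pre, y u.b < y q) → (∀ v ∈ post, y q < y v.b) →
      q ∈ S' ∧ T' ≤ q ∧ (∀ u ∈ pre', y u.b < y q) ∧ ∀ v ∈ post', y q < y v.b) :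
    mass w y S T pre post ≤ mass w y S' T' pre' post' := by
  refine Finset.sum_le_sum_of_subset fun q hq => ?_
  simp only [Finset.mem_filter] at hq ⊢
  have := h q hq.1 hq.2.1 hq.2.2.1 hq.2.2.2
  tauto

theorem mass_map_shift (S : Finset ℕ) (T d : ℕ) (pre post : List Node) :
    mass w y S T pre (post.map (Node.shift d)) = mass w y S T pre post := by
  simp [mass]

theorem mass_insert {S : Finset ℕ} {t T : ℕ} {pre post : List Node} (ht : t ∉ S) (hT : T ≤ t)
    (h1 : ∀ u ∈ pre, y u.b < y t) (h2 : ∀ v ∈ post, y t < y v.b) :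
    mass w y (insert t S) T pre post = mass w y S T pre post + w t := by
  unfold mass
  rw [Finset.filter_insert, if_pos ⟨hT, h1, h2⟩, Finset.sum_insert (by simp [ht]), add_comm]

theorem mass_add_le {S : Finset ℕ} {T : ℕ} {pre post post' : List Node} {u : Node}
    (hu : u.b ∈ S) (hT : T ≤ u.b) (hpre : ∀ v ∈ pre, y v.b < y u.b) (hmem : u ∈ post)
    (hpost : ∀ v ∈ post', y u.b < y v.b) :
    mass w y S T pre post + w u.b ≤ mass w y S T pre post' := by
  unfold mass
  rw [add_comm, ← Finset.sum_insert (f := w) (a := u.b)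
    (fun h => lt_irrefl _ ((Finset.mem_filter.mp h).2.2.2 u hmem))]
  refine Finset.sum_le_sum_of_subset fun q hq => ?_
  simp only [Finset.mem_insert, Finset.mem_filter] at hq ⊢
  rcases hq with rfl | hq
  · exact ⟨hu, hT, hpre, hpost⟩
  · exact ⟨hq.1, hq.2.1, hq.2.2.1, fun v hv => (hq.2.2.2 u hmem).trans (hpost v hv)⟩

theorem below_insert_of_lt {S : Finset ℕ} {t b : ℕ} (ht : t ∉ S) (h : y t < y b) :
    below w y (insert t S) b = below w y S b + w t := by
  unfold below
  rw [Finset.filter_insert, if_pos h, Finset.sum_insert (by simp [ht]), add_comm]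

theorem below_insert_of_not_lt {S : Finset ℕ} {t b : ℕ} (h : ¬ y t < y b) :
    below w y (insert t S) b = below w y S b := by
  unfold below
  rw [Finset.filter_insert, if_neg h]

theorem below_add_le {S : Finset ℕ} {a b : ℕ} (ha : a ∈ S) (h : y a < y b) :
    below w y S a + w a ≤ below w y S b := by
  unfold below
  rw [add_comm, ← Finset.sum_insert (f := w) (a := a) (by simp)]
  refine Finset.sum_le_sum_of_subset fun q hq => ?_
  simp only [Finset.mem_insert, Finset.mem_filter] at hq ⊢
  rcases hq with rfl | hq
  · exact ⟨ha, h⟩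
  · exact ⟨hq.1, hq.2.trans h⟩

theorem below_le_below {S : Finset ℕ} {a b : ℕ} (h : y a ≤ y b) :
    below w y S a ≤ below w y S b := by
  refine Finset.sum_le_sum_of_subset fun q hq => ?_
  simp only [Finset.mem_filter] at hq ⊢
  exact ⟨hq.1, hq.2.trans_le h⟩

theorem below_le_total (S : Finset ℕ) (b : ℕ) : below w y S b ≤ ∑ q ∈ S, w q :=
  Finset.sum_le_sum_of_subset (Finset.filter_subset _ _)

end mass

theorem below_self_insert {α : Type*} [LinearOrder α] {w : ℕ → ℕ} {y : ℕ → α} {S : Finset ℕ}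
    {t : ℕ} : below w y (insert t S) t = below w y S t :=
  below_insert_of_not_lt (lt_irrefl _)

section Inv

variable {α : Type*} [LinearOrder α] {w E : ℕ → ℕ} {y : ℕ → α} {t W : ℕ} {S : Finset ℕ}
  {L : List Node}

theorem inv_zero : Inv w E y 0 ∅ 0 [] where
  sorted := .nil
  sub := by simp
  lt := by simp
  total := by simp
  mono := .nil
  delta := by simp
  rank_lo := by simp
  rank_hi := by simp
  gap := by
    intro pre post h
    obtain ⟨rfl, rfl⟩ := List.append_eq_nil_iff.mp h.symm
    simp [highEnd]
  cut := by
    intro T hT pre mid post h _ _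
    obtain ⟨rfl, h'⟩ := List.append_eq_nil_iff.mp h.symm
    obtain ⟨rfl, rfl⟩ := List.append_eq_nil_iff.mp h'
    exact ⟨0, hT.1, le_rfl, by simp, by simp [highEnd]⟩
  young := by
    intro T hT pre mid d post h
    simp at h

/-- Time passes and no item is inserted. -/
theorem Inv.tick (hE : Monotone E) (h : Inv w E y t S W L) : Inv w E y (t + 1) S W L where
  sorted := h.sorted
  sub := h.sub
  lt q hq := (h.lt q hq).trans (Nat.lt_succ_self t)
  total := h.total
  mono := h.mono
  delta := h.delta
  rank_lo := h.rank_lo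
  rank_hi := h.rank_hi
  gap pre post hL := (h.gap pre post hL).trans (by have := hE (Nat.le_succ t); simp at this; omega)
  cut := by
    intro T hT pre mid post hL hmid hends
    rcases Nat.lt_or_ge t T with hlt | hge
    · have hmid0 : mid = [] := by
        rcases mid with _ | ⟨z, mid⟩
        · rfl
        · have h1 := hmid z (by simp)
          have h2 := h.lt _ (h.sub z (by simp [hL]))
          omega
      subst hmid0
      have h1 := h.gap pre post (by simpa using hL)
      have h2 := hE (Nat.le_succ t)
      simp only [Nat.succ_eq_add_one] at h2
      exact ⟨t + 1, hT.1, le_rfl, by simp, by omega⟩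
    · obtain ⟨s, h1, h2, h3⟩ := h.cut T (hT.mono hge (Nat.le_succ t)) pre mid post hL hmid hends
      exact ⟨s, h1, by omega, h3⟩
  young := by
    intro T hT pre mid d post hL hmid hd hp
    have h2 := h.lt _ (h.sub d (by simp [hL]))
    exact h.young T (hT.mono (by omega) (Nat.le_succ t)) pre mid d post hL hmid hd hp

/-- A permitted drop preserves the invariant. -/
theorem Inv.drop (h : Inv w E y t S W L) {L' : List Node} (hd : Drop w E t W L L') :
    Inv w E y t S W L' := by
  obtain ⟨p, m, j, hm, hL, hL', hgap, hcls⟩ := hd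
  have hsub : L'.Sublist L := by
    rw [hL, hL']
    exact List.Sublist.append_left (List.sublist_append_right _ _) _
  refine ⟨h.sorted.sublist hsub, fun v hv => h.sub v (hsub.subset hv), h.lt, h.total,
    h.mono.sublist hsub, fun v hv => h.delta v (hsub.subset hv),
    fun v hv => h.rank_lo v (hsub.subset hv), fun v hv => h.rank_hi v (hsub.subset hv), ?_, ?_, ?_⟩
  · intro pre post hpp
    have hpp' : p ++ j = pre ++ ([] ++ post) := by simpa [hL'] using hpp
    rcases append_eq_append_three hpp' with ⟨c, hc, rfl, rfl⟩ | ⟨c, hc, rfl, rfl⟩ |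
      ⟨m1, m2, h0, rfl, rfl⟩
    · have := h.gap (p ++ (m ++ c)) post (by simp [hL])
      rwa [lowEnd_append hc, ← List.append_assoc, lowEnd_append hc] at *
    · have := h.gap pre (c ++ (m ++ j)) (by simp [hL])
      rwa [highEnd_append hc] at *
    · obtain ⟨rfl, rfl⟩ := List.append_eq_nil_iff.mp h0.symm
      simpa using hgap
  · intro T hT pre mid post hpp hmid hends
    -- only if the dropped run lay between the same two nodes is the old statement not enough, and
    -- then the gap is within the tolerance at the present time
    rcases append_eq_append_three (hL'.symm.trans hpp) with ⟨c, hc, rfl, rfl⟩ |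
      ⟨c, hc, rfl, rfl⟩ | ⟨m1, m2, rfl, rfl, rfl⟩
    · obtain ⟨s, h1, h2, h3, h4⟩ := h.cut T hT (p ++ (m ++ c)) mid post (by simp [hL]) hmid (by
        unfold OlderEnds at *
        rwa [← List.append_assoc, List.getLast?_append_of_ne_nil _ hc,
          ← List.getLast?_append_of_ne_nil p hc])
      refine ⟨s, h1, h2, h3, ?_⟩
      rw [← List.append_assoc, lowEnd_append hc] at h4
      rw [lowEnd_append hc]
      refine h4.trans (Nat.add_le_add_left (mass_le_mass ?_) _)
      intro q hq h5 h6 h7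
      exact ⟨hq, h5, fun u hu => h6 u (by simp at hu ⊢; tauto), h7⟩
    · obtain ⟨s, h1, h2, h3, h4⟩ := h.cut T hT pre mid (c ++ (m ++ j)) (by simp [hL]) hmid (by
        unfold OlderEnds at *
        rwa [List.head?_append_of_ne_nil _ hc] at *)
      refine ⟨s, h1, h2, h3, ?_⟩
      rw [highEnd_append hc] at h4
      rw [highEnd_append hc]
      refine h4.trans (Nat.add_le_add_left (mass_le_mass ?_) _)
      intro q hq h5 h6 h7
      exact ⟨hq, h5, h6, fun u hu => h7 u (by simp at hu ⊢; tauto)⟩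
    · by_cases hmT : ∀ z ∈ m, T ≤ z.b
      · obtain ⟨s, h1, h2, h3, h4⟩ := h.cut T hT pre (m1 ++ (m ++ m2)) post (by simp [hL])
          (by
            intro z hz
            simp only [List.mem_append] at hz hmid
            rcases hz with hz | hz | hz
            · exact hmid z (.inl hz)
            · exact hmT z hz
            · exact hmid z (.inr hz)) hends
        exact ⟨s, h1, h2, fun z hz => h3 z (by simp at hz ⊢; tauto), h4⟩
      · push Not at hmT
        obtain ⟨e1, e2⟩ := hcls T hT hmT
        have hm1 : m1 = [] := by
          by_contra hne
          rw [List.getLast?_append_of_ne_nil _ hne, List.getLast?_eq_getLast_of_ne_nil hne] at e1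
          have := e1 _ rfl
          have := hmid (m1.getLast hne) (by simp)
          omega
        have hm2 : m2 = [] := by
          by_contra hne
          rw [List.head?_append_of_ne_nil _ hne, List.head?_eq_some_head hne] at e2
          have := e2 _ rfl
          have := hmid (m2.head hne) (by simp)
          omega
        subst hm1 hm2
        simp only [List.append_nil, List.nil_append] at hgap
        exact ⟨t, hT.1, le_rfl, by simp, hgap.trans (Nat.le_add_right _ _)⟩
  · intro T hT pre mid d post hpp hmid hdT hp
    rcases append_eq_append_three (hL'.symm.trans hpp) with ⟨c, hc, rfl, rfl⟩ |
      ⟨c, hc, hcj, rfl⟩ | ⟨m1, m2, rfl, rfl, rfl⟩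
    · have h4 := h.young T hT (p ++ (m ++ c)) mid d post (by simp [hL]) hmid hdT (by
        rwa [← List.append_assoc, List.getLast?_append_of_ne_nil _ hc,
          ← List.getLast?_append_of_ne_nil p hc])
      rw [← List.append_assoc, lowEnd_append hc] at h4
      rw [lowEnd_append hc]
      refine h4.trans (Nat.add_le_add_left (mass_le_mass ?_) _)
      intro q hq h5 h6 h7
      exact ⟨hq, h5, fun u hu => h6 u (by simp at hu ⊢; tauto), h7⟩
    · rcases c with _ | ⟨d', c⟩
      · exact absurd rfl hc
      · obtain ⟨rfl, rfl⟩ : d = d' ∧ post = c ++ j := by simpa using hcj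
        have h4 := h.young T hT pre mid d (c ++ (m ++ j)) (by simp [hL]) hmid hdT hp
        refine h4.trans (Nat.add_le_add_left (mass_le_mass ?_) _)
        intro q hq h5 h6 h7
        exact ⟨hq, h5, h6, fun u hu => h7 u (by simp at hu ⊢; tauto)⟩
    · by_cases hmT : ∀ z ∈ m, T ≤ z.b
      · exact h.young T hT pre (m1 ++ (m ++ m2)) d post (by simp [hL])
          (by
            intro z hz
            simp only [List.mem_append] at hz hmid
            rcases hz with hz | hz | hz
            · exact hmid z (.inl hz)
            · exact hmT z hz
            · exact hmid z (.inr hz)) hdT hp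
      · push Not at hmT
        obtain ⟨e1, e2⟩ := hcls T hT hmT
        rcases m2 with _ | ⟨z, m2⟩
        · have := e2 d (by simp)
          omega
        · have := e2 z (by simp)
          have := hmid z (by simp)
          omega

/-- The node list after the insertion of the item `t` (of weight `w t`) between `l₁` and `l₂`. -/
def insertNode (w : ℕ → ℕ) (t W : ℕ) (l₁ l₂ : List Node) : List Node :=
  l₁ ++ ⟨t, lowEnd w l₁, highEnd W l₂⟩ :: l₂.map (Node.shift (w t))

/-- The lower bound that a new item after the nodes `L` receives is correct. -/
theorem lowEnd_le_below (h : ∀ v ∈ L, v.lo ≤ below w y S v.b) (hsub : ∀ v ∈ L, v.b ∈ S) {b : ℕ}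
    (hb : ∀ v ∈ L, y v.b < y b) : lowEnd w L ≤ below w y S b := by
  rcases List.eq_nil_or_concat' L with rfl | ⟨l, a, rfl⟩
  · simp [lowEnd]
  · rw [lowEnd_concat]
    have h1 := h a (by simp)
    have h2 := below_add_le (w := w) (hsub a (by simp)) (hb a (by simp))
    omega

/-- The upper bound that a new item before the nodes `L` receives is correct. -/
theorem below_le_highEnd (h : ∀ v ∈ L, below w y S v.b ≤ v.hi) (hW : W = ∑ q ∈ S, w q) {b : ℕ}
    (hb : ∀ v ∈ L, y b < y v.b) : below w y S b ≤ highEnd W L := by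
  rcases L with _ | ⟨a, l⟩
  · simpa [highEnd, hW] using below_le_total S b
  · exact (below_le_below (hb a (by simp)).le).trans (h a (by simp))

/-- The insertion of the item `t` preserves the invariant: it splits a gap into two gaps of the same
width, and every older gap that contains it grows by its weight. -/
theorem Inv.insert (hE : Monotone E) {l₁ l₂ : List Node} (h : Inv w E y t S W (l₁ ++ l₂))
    (h₁ : ∀ v ∈ l₁, y v.b < y t) (h₂ : ∀ v ∈ l₂, y t < y v.b) :
    Inv w E y (t + 1) (insert t S) (W + w t) (insertNode w t W l₁ l₂) := by
  have ht : t ∉ S := fun ht => lt_irrefl _ (h.lt t ht)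
  have hEt : E t ≤ E (t + 1) := hE (Nat.le_succ t)
  have hbl : ∀ v ∈ l₁ ++ l₂, v.b < t := fun v hv => h.lt _ (h.sub v hv)
  -- a gap of the new list is one of the old gaps
  have gap' : ∀ pre post, insertNode w t W l₁ l₂ = pre ++ post →
      highEnd (W + w t) post ≤ lowEnd w pre + E t := by
    intro pre post hpp
    have hpp' : l₁ ++ ⟨t, lowEnd w l₁, highEnd W l₂⟩ :: l₂.map (Node.shift (w t)) =
        pre ++ ([] ++ post) := hpp
    rcases append_eq_append_three hpp' with ⟨c, hc, rfl, hc2⟩ | ⟨c, hc, rfl, rfl⟩ |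
      ⟨m1, m2, h0, rfl, hc2⟩
    · rcases c with _ | ⟨x, c⟩
      · exact absurd rfl hc
      · obtain ⟨rfl, hc3⟩ := List.cons.inj hc2
        obtain ⟨c', post', rfl, rfl, rfl⟩ := List.map_eq_append_iff.mp hc3
        rw [highEnd_map_shift]
        by_cases hc' : c' = []
        · subst hc'
          have := h.gap l₁ post' (by simp)
          simp only [List.map_nil, lowEnd_concat]
          omega
        · have := h.gap (l₁ ++ c') post' (by simp)
          rw [lowEnd_append hc'] at this
          rw [lowEnd_append_cons _ _ (by simpa using hc'), lowEnd_map_shift _ hc']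
          omega
    · have := h.gap pre (c ++ l₂) (by simp)
      rw [highEnd_append hc, highEnd_congr W hc]
      rwa [highEnd_append hc] at this
    · obtain ⟨rfl, rfl⟩ := List.append_eq_nil_iff.mp h0.symm
      have := h.gap pre l₂ (by simp)
      simp only [List.nil_append] at hc2
      subst hc2
      simpa [highEnd] using this
  have hm := List.pairwise_append.mp h.mono
  have hs := List.pairwise_append.mp h.sorted
  refine ⟨?_, ?_, ?_, ?_, ?_, ?_, ?_, ?_, ?_, ?_, ?_⟩
  · simp only [insertNode, List.pairwise_append, List.pairwise_cons, List.pairwise_map,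
      List.mem_cons, List.mem_map, forall_eq_or_imp, forall_exists_index, and_imp,
      forall_apply_eq_imp_iff₂, Node.shift_b]
    exact ⟨hs.1, ⟨h₂, hs.2.1⟩, fun u hu => ⟨h₁ u hu, fun v hv => hs.2.2 u hu v hv⟩⟩
  · simp only [insertNode, List.mem_append, List.mem_cons, List.mem_map]
    rintro v (hv | rfl | ⟨v, hv, rfl⟩)
    · exact Finset.mem_insert_of_mem (h.sub v (by simp [hv]))
    · exact Finset.mem_insert_self _ _
    · exact Finset.mem_insert_of_mem (h.sub v (by simp [hv]))
  · intro q hq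
    rcases Finset.mem_insert.mp hq with rfl | hq
    · omega
    · exact (h.lt q hq).trans (Nat.lt_succ_self t)
  · rw [Finset.sum_insert ht, h.total, add_comm]
  · simp only [insertNode, List.pairwise_append, List.pairwise_cons, List.pairwise_map,
      List.mem_cons, List.mem_map, forall_eq_or_imp, forall_exists_index, and_imp,
      forall_apply_eq_imp_iff₂, Node.shift_b, Node.shift_lo]
    refine ⟨hm.1, ⟨fun v hv => ?_, hm.2.1.imp fun huv => by omega⟩,
      fun u hu => ⟨le_lowEnd hm.1 u hu, fun v hv => ?_⟩⟩
    · exact Nat.add_le_add_right (lowEnd_le fun u hu => hm.2.2 u hu v hv) _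
    · exact (hm.2.2 u hu v hv).trans (Nat.le_add_right _ _)
  · simp only [insertNode, List.mem_append, List.mem_cons, List.mem_map]
    rintro v (hv | rfl | ⟨v, hv, rfl⟩)
    · exact h.delta v (by simp [hv])
    · exact h.gap _ _ rfl
    · have := h.delta v (by simp [hv])
      simp only [Node.shift_b, Node.shift_lo, Node.shift_hi]
      omega
  · simp only [insertNode, List.mem_append, List.mem_cons, List.mem_map]
    rintro v (hv | rfl | ⟨v, hv, rfl⟩)
    · rw [below_insert_of_not_lt (h₁ v hv).asymm]
      exact h.rank_lo v (by simp [hv])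
    · rw [below_self_insert]
      exact lowEnd_le_below (fun v hv => h.rank_lo v (by simp [hv]))
        (fun v hv => h.sub v (by simp [hv])) h₁
    · rw [Node.shift_b, below_insert_of_lt ht (h₂ v hv)]
      exact Nat.add_le_add_right (h.rank_lo v (by simp [hv])) _
  · simp only [insertNode, List.mem_append, List.mem_cons, List.mem_map]
    rintro v (hv | rfl | ⟨v, hv, rfl⟩)
    · rw [below_insert_of_not_lt (h₁ v hv).asymm]
      exact h.rank_hi v (by simp [hv])
    · rw [below_self_insert]
      exact below_le_highEnd (fun v hv => h.rank_hi v (by simp [hv])) h.total h₂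
    · rw [Node.shift_b, below_insert_of_lt ht (h₂ v hv)]
      exact Nat.add_le_add_right (h.rank_hi v (by simp [hv])) _
  · intro pre post hpp
    exact (gap' pre post hpp).trans (Nat.add_le_add_left hEt _)
  · intro T hT pre mid post hpp hmid hends
    rcases Nat.lt_or_ge t T with hlt | hge
    · have hmid0 : mid = [] := by
        rcases mid with _ | ⟨z, mid⟩
        · rfl
        · have h1 := hmid z (by simp)
          have hz : z ∈ insertNode w t W l₁ l₂ := by simp [hpp]
          simp only [insertNode, List.mem_append, List.mem_cons, List.mem_map] at hz
          rcases hz with hz | rfl | ⟨z, hz, rfl⟩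
          · have := hbl z (by simp [hz])
            omega
          · simp only at h1
            omega
          · have := hbl z (by simp [hz])
            simp only [Node.shift_b] at h1
            omega
      subst hmid0
      have h1 := gap' pre post (by simpa using hpp)
      exact ⟨t + 1, hT.1, le_rfl, by simp, by omega⟩
    have hTt := hT.mono hge (Nat.le_succ t)
    -- the new node is too young to be one of the two ends; if it lies between them, then the gap
    -- and the mass both grow by its weight
    rcases append_eq_append_three hpp with ⟨c, hc, rfl, hc2⟩ | ⟨c, hc, rfl, rfl⟩ |
      ⟨m1, m2, rfl, rfl, hc2⟩
    · rcases c with _ | ⟨x, c⟩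
      · exact absurd rfl hc
      obtain ⟨rfl, hc3⟩ := List.cons.inj hc2
      obtain ⟨c', r, rfl, rfl, hr⟩ := List.map_eq_append_iff.mp hc3
      obtain ⟨mid', post', rfl, rfl, rfl⟩ := List.map_eq_append_iff.mp hr
      by_cases hc' : c' = []
      · subst hc'
        have := hends.1 ⟨t, lowEnd w l₁, highEnd W ([] ++ (mid' ++ post'))⟩ (by simp)
        simp only at this
        omega
      obtain ⟨s, h1, h2, h3, h4⟩ := h.cut T hTt (l₁ ++ c') mid' post' (by simp)
        (by simpa using hmid) (by
          unfold OlderEnds at hends ⊢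
          rw [List.getLast?_append_of_ne_nil _ (by simp), List.getLast?_cons_of_ne_nil
            (by simpa using hc')] at hends
          rw [List.getLast?_append_of_ne_nil _ hc']
          simpa using hends)
      refine ⟨s, h1, by omega, by simpa using h3, ?_⟩
      rw [lowEnd_append hc'] at h4
      rw [lowEnd_append_cons _ _ (by simpa using hc'), lowEnd_map_shift _ hc', highEnd_map_shift,
        mass_map_shift]
      have h5 : mass w y S s (l₁ ++ c') post' ≤ mass w y (Insert.insert t S) s
          (l₁ ++ ⟨t, lowEnd w l₁, highEnd W (c' ++ (mid' ++ post'))⟩ ::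
            c'.map (Node.shift (w t))) post' := by
        refine mass_le_mass fun q hq h6 h7 h8 => ⟨Finset.mem_insert_of_mem hq, h6, ?_, h8⟩
        simp only [List.mem_append, List.mem_cons, List.mem_map]
        rintro u (hu | rfl | ⟨u, hu, rfl⟩)
        · exact h7 u (by simp [hu])
        · obtain ⟨v, hv⟩ := List.exists_mem_of_ne_nil _ hc'
          exact (h₂ v (by simp [hv])).trans (h7 v (by simp [hv]))
        · exact h7 u (by simp [hu])
      omega
    · obtain ⟨s, h1, h2, h3, h4⟩ := h.cut T hTt pre mid (c ++ l₂) (by simp)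
        hmid (by
          unfold OlderEnds at hends ⊢
          rwa [List.head?_append_of_ne_nil _ hc] at *)
      refine ⟨s, h1, by omega, h3, ?_⟩
      rw [highEnd_append hc] at h4
      rw [highEnd_append hc, highEnd_congr W hc]
      refine h4.trans (Nat.add_le_add_left (mass_le_mass ?_) _)
      intro q hq h6 h7 h8
      refine ⟨Finset.mem_insert_of_mem hq, h6, h7, ?_⟩
      simp only [List.mem_append, List.mem_cons, List.mem_map]
      rintro u (hu | rfl | ⟨u, hu, rfl⟩)
      · exact h8 u (by simp [hu])
      · obtain ⟨v, hv⟩ := List.exists_mem_of_ne_nil _ hc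
        exact (h8 v (by simp [hv])).trans (h₁ v (by simp [hv]))
      · exact h8 u (by simp [hu])
    · rcases m2 with _ | ⟨x, m2⟩
      · simp only [List.nil_append] at hc2
        subst hc2
        have := hends.2 ⟨t, lowEnd w (pre ++ m1), highEnd W l₂⟩ (by simp)
        simp only at this
        omega
      obtain ⟨rfl, hc3⟩ := List.cons.inj hc2
      obtain ⟨m', post', rfl, rfl, rfl⟩ := List.map_eq_append_iff.mp hc3
      obtain ⟨s, h1, h2, h3, h4⟩ := h.cut T hTt pre (m1 ++ m') post' (by simp)
        (by
          intro z hz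
          rcases List.mem_append.mp hz with hz | hz
          · exact hmid z (by simp [hz])
          · exact hmid (z.shift (w t)) (by
              simp only [List.mem_append, List.mem_cons]
              exact .inr (.inr (List.mem_map_of_mem hz)))) (by
          unfold OlderEnds at hends ⊢
          simpa using hends)
      refine ⟨s, h1, by omega, ?_, ?_⟩
      · simp only [List.mem_append, List.mem_cons, List.mem_map]
        rintro u (hu | rfl | ⟨u, hu, rfl⟩)
        · exact h3 u (by simp [hu])
        · exact h2
        · exact h3 u (by simp [hu])
      · rw [highEnd_map_shift, mass_map_shift, mass_insert ht h2
          (fun u hu => h₁ u (by simp [hu])) (fun u hu => h₂ u (by simp [hu]))]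
        omega
  · intro T hT pre mid d post hpp hmid hdT hp
    have hTt : IsCut t T := by
      refine hT.mono ?_ (Nat.le_succ t)
      have hd : d ∈ insertNode w t W l₁ l₂ := by simp [hpp]
      simp only [insertNode, List.mem_append, List.mem_cons, List.mem_map] at hd
      rcases hd with hd | rfl | ⟨d, hd, rfl⟩
      · have := hbl d (by simp [hd])
        omega
      · exact hdT
      · have := hbl d (by simp [hd])
        simp only [Node.shift_b] at hdT
        omega
    have hge := hTt.1
    rcases append_eq_append_three hpp with ⟨c, hc, rfl, hc2⟩ | ⟨c, hc, hcj, rfl⟩ |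
      ⟨m1, m2, rfl, rfl, hc2⟩
    · rcases c with _ | ⟨x, c⟩
      · exact absurd rfl hc
      obtain ⟨rfl, hc3⟩ := List.cons.inj hc2
      obtain ⟨c', r, rfl, rfl, hr⟩ := List.map_eq_append_iff.mp hc3
      obtain ⟨mid', post', rfl, rfl, hr2⟩ := List.map_eq_append_iff.mp hr
      obtain ⟨d', post'', rfl, rfl, rfl⟩ := List.map_eq_cons_iff.mp hr2
      by_cases hc' : c' = []
      · subst hc'
        have := hp ⟨t, lowEnd w l₁, highEnd W ([] ++ (mid' ++ d' :: post''))⟩ (by simp)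
        simp only at this
        omega
      have h4 := h.young T hTt (l₁ ++ c') mid' d' post'' (by simp)
        (by simpa using hmid) hdT (by
          rw [List.getLast?_append_of_ne_nil _ (by simp), List.getLast?_cons_of_ne_nil
            (by simpa using hc')] at hp
          rw [List.getLast?_append_of_ne_nil _ hc']
          simpa using hp)
      rw [lowEnd_append hc'] at h4
      rw [lowEnd_append_cons _ _ (by simpa using hc'), lowEnd_map_shift _ hc', ← List.map_cons,
        mass_map_shift, Node.shift_lo]
      have h5 : mass w y S T (l₁ ++ c') (d' :: post'') ≤ mass w y (Insert.insert t S) T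
          (l₁ ++ ⟨t, lowEnd w l₁, highEnd W (c' ++ (mid' ++ d' :: post''))⟩ ::
            c'.map (Node.shift (w t))) (d' :: post'') := by
        refine mass_le_mass fun q hq h6 h7 h8 => ⟨Finset.mem_insert_of_mem hq, h6, ?_, h8⟩
        simp only [List.mem_append, List.mem_cons, List.mem_map]
        rintro u (hu | rfl | ⟨u, hu, rfl⟩)
        · exact h7 u (by simp [hu])
        · obtain ⟨v, hv⟩ := List.exists_mem_of_ne_nil _ hc'
          exact (h₂ v (by simp [hv])).trans (h7 v (by simp [hv]))
        · exact h7 u (by simp [hu])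
      omega
    · rcases c with _ | ⟨d', c⟩
      · exact absurd rfl hc
      obtain ⟨rfl, rfl⟩ := List.cons.inj hcj
      have h4 := h.young T hTt pre mid d (c ++ l₂) (by simp) hmid hdT hp
      refine h4.trans (Nat.add_le_add_left (mass_le_mass ?_) _)
      intro q hq h6 h7 h8
      refine ⟨Finset.mem_insert_of_mem hq, h6, h7, ?_⟩
      simp only [List.mem_append, List.mem_cons, List.mem_map, List.append_eq]
      rintro u (rfl | hu | rfl | ⟨u, hu, rfl⟩)
      · exact h8 u (by simp)
      · exact h8 u (by simp [hu])
      · exact (h8 d (by simp)).trans (h₁ d (by simp))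
      · exact h8 u (by simp [hu])
    · rcases m2 with _ | ⟨x, m2⟩
      · obtain ⟨rfl, rfl⟩ := List.cons.inj hc2
        rcases List.eq_nil_or_concat' m1 with rfl | ⟨m1, u, rfl⟩
        · simp
        -- the lower bound of the new node is that of its left neighbour `u` plus the weight of `u`
        have hu : T ≤ u.b := hmid u (by simp)
        have h4 := h.young T hTt pre m1 u l₂ (by simp) (fun z hz => hmid z (by simp [hz])) hu hp
        have h5 := mass_add_le (w := w) (T := T) (pre := pre) (post := u :: l₂)
          (post' := ⟨t, lowEnd w (pre ++ (m1 ++ [u])), highEnd W l₂⟩ ::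
            l₂.map (Node.shift (w t))) (h.sub u (by simp)) hu
          (fun v hv => (List.pairwise_append.mp hs.1).2.2 v hv u (by simp)) (by simp) (by
            simp only [List.mem_cons, List.mem_map]
            rintro v (rfl | ⟨v, hv, rfl⟩)
            · exact h₁ u (by simp)
            · exact hs.2.2 u (by simp) v hv)
        have h6 : mass w y S T pre (⟨t, lowEnd w (pre ++ (m1 ++ [u])), highEnd W l₂⟩ ::
            l₂.map (Node.shift (w t))) ≤ mass w y (Insert.insert t S) T pre
            (⟨t, lowEnd w (pre ++ (m1 ++ [u])), highEnd W l₂⟩ :: l₂.map (Node.shift (w t))) :=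
          mass_le_mass fun q hq h7 h8 h9 => ⟨Finset.mem_insert_of_mem hq, h7, h8, h9⟩
        simp only [← List.append_assoc, lowEnd_concat] at h5 h6 ⊢
        omega
      obtain ⟨rfl, hc3⟩ := List.cons.inj hc2
      obtain ⟨m', post', rfl, rfl, hr2⟩ := List.map_eq_append_iff.mp hc3
      obtain ⟨d', post'', rfl, rfl, rfl⟩ := List.map_eq_cons_iff.mp hr2
      have h4 := h.young T hTt pre (m1 ++ m') d' post'' (by simp)
        (by
          intro z hz
          rcases List.mem_append.mp hz with hz | hz
          · exact hmid z (by simp [hz])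
          · exact hmid (z.shift (w t)) (by
              simp only [List.mem_append, List.mem_cons]
              exact .inr (.inr (List.mem_map_of_mem hz)))) hdT hp
      rw [← List.map_cons, mass_map_shift, mass_insert ht hge
          (fun u hu => h₁ u (by simp [hu])) (fun u hu => h₂ u (by
            simp only [List.mem_append]; exact .inr hu)), Node.shift_lo]
      omega

end Inv

section reduce

variable (w E : ℕ → ℕ) (t W : ℕ)

theorem Drop.length_lt {L L' : List Node} (h : Drop w E t W L L') : L'.length < L.length := by
  obtain ⟨pre, mid, post, hm, rfl, rfl, -, -⟩ := h
  have := List.length_pos_iff.mpr hm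
  simp only [List.length_append]
  omega

theorem exists_stuck (L : List Node) : ∃ L', Relation.ReflTransGen (Drop w E t W) L L' ∧
    ∀ L'', ¬ Drop w E t W L' L'' := by
  induction hn : L.length using Nat.strong_induction_on generalizing L with
  | _ n ih =>
    by_cases h : ∃ L'', Drop w E t W L L''
    · obtain ⟨L'', hL⟩ := h
      obtain ⟨L', h1, h2⟩ := ih _ (hn ▸ hL.length_lt) L'' rfl
      exact ⟨L', .head hL h1, h2⟩
    · exact ⟨L, .refl, fun L'' hL => h ⟨L'', hL⟩⟩

/-- Permitted drops are carried out until none is left. -/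
def reduce (L : List Node) : List Node := (exists_stuck w E t W L).choose

theorem reduce_stuck (L L'' : List Node) : ¬ Drop w E t W (reduce w E t W L) L'' :=
  (exists_stuck w E t W L).choose_spec.2 L''

theorem reduce_sublist (L : List Node) : (reduce w E t W L).Sublist L := by
  have key : ∀ L', Relation.ReflTransGen (Drop w E t W) L L' → L'.Sublist L := by
    intro L' h
    induction h with
    | refl => exact .refl _
    | tail _ hd ih =>
      obtain ⟨pre, mid, post, -, rfl, rfl, -, -⟩ := hd
      exact .trans (List.Sublist.append_left (List.sublist_append_right _ _) _) ih
  exact key _ (exists_stuck w E t W L).choose_spec.1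

variable {w E t W}

theorem Inv.reduce {α : Type*} [LinearOrder α] {y : ℕ → α} {S : Finset ℕ} {L : List Node}
    (h : Inv w E y t S W L) : Inv w E y t S W (reduce w E t W L) := by
  have key : ∀ L', Relation.ReflTransGen (Drop w E t W) L L' → Inv w E y t S W L' := by
    intro L' hr
    induction hr with
    | refl => exact h
    | tail _ hd ih => exact ih.drop hd
  exact key _ (exists_stuck w E t W L).choose_spec.1

end reduce

/-! ### The number of stored nodes -/

/-- If the lower bound of each node of a list exceeds that of the last but one by `K`, and no lower
bound exceeds that of the first node by more than `N`, then the list has at most about `2 N / K`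
nodes. -/
theorem length_sub_two_mul_le {K N B : ℕ} : ∀ l : List Node,
    (∀ p a b c s, l = p ++ a :: b :: c :: s → a.lo + K ≤ c.lo) →
    (∀ d ∈ l.head?, B ≤ d.lo) → (∀ d ∈ l, d.lo ≤ B + N) → (l.length - 2) * K ≤ 2 * N
  | [], _, _, _ => by simp
  | [_], _, _, _ => by simp
  | [_, _], _, _, _ => by simp
  | a :: b :: c :: s, h, hB, hN => by
    have h1 := h [] a b c s rfl
    have ha := hB a (by simp)
    have hc := hN c (by simp)
    have ih := length_sub_two_mul_le (K := K) (N := B + N - c.lo) (B := c.lo) (c :: s)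
      (fun p a' b' c' s' hs => h (a :: b :: p) a' b' c' s' (by simp [hs]))
      (by simp) (fun d hd => by
        have := hN d (by simp at hd ⊢; tauto)
        omega)
    have : (a :: b :: c :: s).length - 2 ≤ ((c :: s).length - 2) + 2 := by
      simp only [List.length_cons]
      omega
    calc ((a :: b :: c :: s).length - 2) * K ≤ (((c :: s).length - 2) + 2) * K :=
          Nat.mul_le_mul_right _ this
      _ = ((c :: s).length - 2) * K + 2 * K := by ring
      _ ≤ 2 * N := by omega

variable {α : Type*} [LinearOrder α] {w E : ℕ → ℕ} {y : ℕ → α} {t W : ℕ} {S : Finset ℕ}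
  {L : List Node}

/-- The nodes that arrived between the times `T` and `T'`. -/
def bandCount (T T' : ℕ) (L : List Node) : ℕ := L.countP fun z => decide (T ≤ z.b ∧ z.b < T')

/-- The nodes of one age class between two adjacent older nodes are paid for by the items that have
arrived between these older nodes since `T`. -/
theorem Inv.bandCount_mul_le_of_gap (h : Inv w E y t S W L) (hE : Monotone E)
    (hs : ∀ L', ¬ Drop w E t W L L') {T T' : ℕ} (hT : IsCut t T) (hT' : T' ≤ t)
    (hcons : ∀ T'', IsCut t T'' → ¬ (T < T'' ∧ T'' < T')) {pre mid post : List Node}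
    (hL : L = pre ++ (mid ++ post)) (hmid : ∀ z ∈ mid, T ≤ z.b) (hends : OlderEnds T pre post) :
    bandCount T T' mid * (E t + 1 - E T') ≤ 4 * mass w y S T pre post := by
  set K := E t + 1 - E T' with hK
  set N := mass w y S T pre post with hN
  set f : Node → Bool := fun z => decide (T ≤ z.b ∧ z.b < T') with hf
  have hEt : E T' ≤ E t := hE hT'
  -- if the class is represented in the gap, then the gap has received more than `K`
  have hone : ∀ z ∈ mid, z.b < T' → K ≤ N := by
    intro z hz hzT
    have hst := hs (pre ++ post)
    have hgap : ¬ highEnd W post ≤ lowEnd w pre + E t := fun hg => hst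
      ⟨pre, mid, post, List.ne_nil_of_mem hz, hL, rfl, hg, by
        rintro T'' - ⟨z, hz, hzT⟩
        have := hmid z hz
        exact ⟨fun p hp => (hends.1 p hp).trans (by omega),
          fun p hp => (hends.2 p hp).trans (by omega)⟩⟩
    obtain ⟨s, h1, h2, h3, h4⟩ := h.cut T hT pre mid post hL hmid hends
    have h5 : mass w y S s pre post ≤ N :=
      mass_le_mass fun q hq h6 h7 h8 => ⟨hq, h1.trans h6, h7, h8⟩
    have h6 : E s ≤ E T' := hE ((h3 z hz).trans hzT.le)
    omega
  have hcount : bandCount T T' mid = (mid.filter f).length := List.countP_eq_length_filter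
  rw [hcount]
  have hmem : ∀ d ∈ mid.filter f, d ∈ mid ∧ d.b < T' := by
    intro d hd
    simp only [List.mem_filter, hf, decide_eq_true_eq] at hd
    exact ⟨hd.1, hd.2.2⟩
  have htwo : ((mid.filter f).length - 2) * K ≤ 2 * N := by
    refine length_sub_two_mul_le (B := lowEnd w pre) _ ?_ ?_ ?_
    -- in three successive nodes `a`, `b`, `c` of the class, `b` and the younger nodes around it
    -- cannot be dropped, so that the lower bound of `c` exceeds that of `a` by `K`
    · intro p a b c s hl
      obtain ⟨m1, r1, rfl, -, hr1⟩ := List.filter_eq_append_iff.mp hl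
      obtain ⟨m2, r2, rfl, hm2, hfa, hr2⟩ := List.filter_eq_cons_iff.mp hr1
      obtain ⟨m3, r3, rfl, hm3, hfb, hr3⟩ := List.filter_eq_cons_iff.mp hr2
      obtain ⟨m4, r4, rfl, hm4, hfc, hr4⟩ := List.filter_eq_cons_iff.mp hr3
      simp only [hf, decide_eq_true_eq] at hfa hfb hfc
      have hgap : ¬ highEnd W (c :: (r4 ++ post)) ≤ lowEnd w (pre ++ (m1 ++ (m2 ++ [a]))) + E t :=
        fun hg => hs _ ⟨pre ++ (m1 ++ (m2 ++ [a])), m3 ++ b :: m4, c :: (r4 ++ post), by simp,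
          by simp [hL], rfl, hg, by
            rintro T'' hT'' ⟨z, hz, hzT⟩
            have hz' : T ≤ z.b := hmid z (by simp at hz ⊢; tauto)
            have := hcons T'' hT''
            refine ⟨fun p hp => ?_, fun p hp => ?_⟩
            · simp only [← List.append_assoc, List.getLast?_concat, Option.mem_def,
                Option.some.injEq] at hp
              subst hp
              omega
            · simp only [List.head?_cons, Option.mem_def, Option.some.injEq] at hp
              subst hp
              omega⟩
      have hd := h.delta c (by simp [hL])
      have hEc : E c.b ≤ E T' := hE hfc.2.le
      simp only [← List.append_assoc, lowEnd_concat] at hgap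
      simp only [highEnd, List.head?_cons, Option.elim_some] at hgap
      omega
    · intro d hd
      obtain ⟨hd, -⟩ := hmem d (List.mem_of_mem_head? hd)
      refine lowEnd_le fun u hu => ?_
      have hm := h.mono
      rw [hL] at hm
      exact (List.pairwise_append.mp hm).2.2 u hu d (by simp [hd])
    · intro d hd
      obtain ⟨hd, -⟩ := hmem d hd
      obtain ⟨m1, m2, rfl⟩ := List.append_of_mem hd
      refine (h.young T hT pre m1 d (m2 ++ post) (by simp [hL])
        (fun z hz => hmid z (by simp [hz])) (hmid d hd) hends.1).trans ?_
      exact Nat.add_le_add_left (mass_le_mass fun q hq h6 h7 h8 =>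
        ⟨hq, h6, h7, fun v hv => h8 v (by simp [hv])⟩) _
  rcases hl : mid.filter f with _ | ⟨z, l⟩
  · simp
  · have hz := hmem z (by simp [hl])
    have h1 := hone z hz.1 hz.2
    rw [hl] at htwo
    have : (z :: l).length ≤ (z :: l).length - 2 + 2 := by omega
    calc (z :: l).length * K ≤ ((z :: l).length - 2 + 2) * K := Nat.mul_le_mul_right _ this
      _ = ((z :: l).length - 2) * K + 2 * K := by ring
      _ ≤ 4 * N := by omega

theorem mass_add_mass_le {S : Finset ℕ} {T : ℕ} {pre mid post : List Node} {v : Node} :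
    mass w y S T pre (v :: post) + mass w y S T (pre ++ (mid ++ [v])) [] ≤ mass w y S T pre [] := by
  unfold mass
  rw [← Finset.sum_union]
  · refine Finset.sum_le_sum_of_subset fun q hq => ?_
    simp only [Finset.mem_union, Finset.mem_filter] at hq ⊢
    rcases hq with hq | hq
    · exact ⟨hq.1, hq.2.1, hq.2.2.1, by simp⟩
    · exact ⟨hq.1, hq.2.1, fun u hu => hq.2.2.1 u (by simp [hu]), by simp⟩
  · rw [Finset.disjoint_filter]
    intro q _ h1 h2
    exact (h1.2.2 v (by simp)).asymm (h2.2.1 v (by simp))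

/-- In a summary that admits no drop, the number of nodes of the age class between the consecutive
cuts `T` and `T'` is bounded by the weight of the items since `T`, in units of the growth of the
tolerance since `T'`. -/
theorem Inv.bandCount_mul_le (h : Inv w E y t S W L) (hE : Monotone E)
    (hs : ∀ L', ¬ Drop w E t W L L') {T T' : ℕ} (hT : IsCut t T) (hT' : T' ≤ t)
    (hcons : ∀ T'', IsCut t T'' → ¬ (T < T'' ∧ T'' < T')) :
    bandCount T T' L * (E t + 1 - E T') ≤ 4 * ∑ q ∈ S with T ≤ q, w q := by
  have key : ∀ n, ∀ pre suf : List Node, suf.length ≤ n → L = pre ++ suf →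
      (∀ p ∈ pre.getLast?, p.b < T) →
      bandCount T T' suf * (E t + 1 - E T') ≤ 4 * mass w y S T pre [] := by
    intro n
    induction n with
    | zero =>
      intro pre suf hn hL hp
      have : suf = [] := List.length_eq_zero_iff.mp (by omega)
      simp [this, bandCount]
    | succ n ih =>
      intro pre suf hn hL hp
      obtain ⟨mid, rest, hmr, hmid, hrest⟩ : ∃ mid rest, suf = mid ++ rest ∧
          (∀ z ∈ mid, T ≤ z.b) ∧ ∀ v ∈ rest.head?, v.b < T := by
        refine ⟨suf.takeWhile fun z => decide (T ≤ z.b), suf.dropWhile fun z => decide (T ≤ z.b),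
          (List.takeWhile_append_dropWhile).symm, fun z hz => ?_, fun v hv => ?_⟩
        · simpa using List.mem_takeWhile_imp hz
        · have := List.head?_dropWhile_not (fun z : Node => decide (T ≤ z.b)) suf
          rw [Option.mem_def.mp hv] at this
          simpa using this
      have hg := h.bandCount_mul_le_of_gap hE hs hT hT' hcons (pre := pre) (mid := mid)
        (post := rest) (by rw [hL, hmr]) hmid ⟨hp, hrest⟩
      rcases rest with _ | ⟨v, rest⟩
      · rw [List.append_nil] at hmr
        rwa [hmr]
      · have hv : v.b < T := hrest v (by simp)
        have ih' := ih (pre ++ (mid ++ [v])) rest (by simp [hmr] at hn ⊢; omega)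
          (by simp [hL, hmr]) (by simpa [← List.append_assoc] using hv)
        have hsum := mass_add_mass_le (w := w) (y := y) (S := S) (T := T) (pre := pre) (mid := mid)
          (post := rest) (v := v)
        have hc : bandCount T T' suf = bandCount T T' mid + bandCount T T' rest := by
          have : ¬ (T ≤ v.b ∧ v.b < T') := by omega
          simp [bandCount, hmr, List.countP_append, this]
        rw [hc, add_mul]
        omega
  have := key L.length [] L le_rfl rfl (by simp)
  simpa [mass] using this

/-! ### Answering a query -/

/-- Whether the bounds of a node guarantee that it is a good answer for the rank `k`. -/
def Good (w E : ℕ → ℕ) (t k : ℕ) (v : Node) : Prop := k ≤ v.lo + w v.b + E t ∧ v.hi + 1 ≤ k + E t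

/-- The first node whose lower bound reaches `k`, or else the last node, is a good answer for `k`:
the gap before it is within the tolerance. -/
theorem Inv.exists_good (h : Inv w E y t S W L) (hE : Monotone E) {k : ℕ}
    (hk1 : 1 ≤ k) (hkW : k ≤ W) (hEW : E t < W) (hw : ∀ q, 0 < w q) :
    ∃ v ∈ L, Good w E t k v := by
  obtain ⟨pre, post, hL, hpre, hpost⟩ : ∃ pre post, L = pre ++ post ∧
      (∀ z ∈ pre, z.lo + w z.b < k) ∧ ∀ v ∈ post.head?, k ≤ v.lo + w v.b := by
    refine ⟨L.takeWhile fun z => decide (z.lo + w z.b < k),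
      L.dropWhile fun z => decide (z.lo + w z.b < k),
      (List.takeWhile_append_dropWhile).symm, fun z hz => ?_, fun v hv => ?_⟩
    · simpa using List.mem_takeWhile_imp hz
    · have := List.head?_dropWhile_not (fun z : Node => decide (z.lo + w z.b < k)) L
      rw [Option.mem_def.mp hv] at this
      simpa using this
  have hg := h.gap pre post hL
  have hlow : lowEnd w pre < k := by
    have := lowEnd_le (w := w) (l := pre) (n := k - 1) fun u hu => Nat.le_sub_one_of_lt (hpre u hu)
    omega
  rcases post with _ | ⟨v, post⟩
  · rcases List.eq_nil_or_concat' pre with rfl | ⟨pre, u, rfl⟩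
    · simp [highEnd, lowEnd] at hg
      omega
    · refine ⟨u, by simp [hL], ?_⟩
      have hd := h.delta u (by simp [hL])
      have hEu : E u.b ≤ E t := hE (h.lt _ (h.sub u (by simp [hL]))).le
      have := hw u.b
      rw [lowEnd_concat] at hg hlow
      simp only [highEnd, List.head?_nil, Option.elim_none] at hg
      constructor <;> omega
  · refine ⟨v, by simp [hL], ?_⟩
    have := hpost v (by simp)
    simp only [highEnd, List.head?_cons, Option.elim_some] at hg
    constructor <;> omega

/-! ### Age classes -/

/-- The largest multiple of `2 ^ k` whose age at time `t` is at least `2 ^ k` (and `0` if there is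
none). -/
def cutTime (t k : ℕ) : ℕ := 2 ^ k * (t / 2 ^ k - 1)

theorem isCut_cutTime (t k : ℕ) : IsCut t (cutTime t k) := by
  have h1 := Nat.div_add_mod t (2 ^ k)
  have h2 := Nat.mod_lt t (Nat.two_pow_pos k)
  have h3 : cutTime t k = 2 ^ k * (t / 2 ^ k) - 2 ^ k := by
    rw [cutTime, Nat.mul_sub, mul_one]
  refine ⟨by omega, k, dvd_mul_right _ _, ?_⟩
  rw [pow_succ]
  omega

theorem lt_cutTime_add (t k : ℕ) : t < cutTime t k + 2 ^ (k + 1) := by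
  have h1 := Nat.div_add_mod t (2 ^ k)
  have h2 := Nat.mod_lt t (Nat.two_pow_pos k)
  have h3 : cutTime t k = 2 ^ k * (t / 2 ^ k) - 2 ^ k := by
    rw [cutTime, Nat.mul_sub, mul_one]
  rw [pow_succ]
  omega

theorem cutTime_add_le {t k : ℕ} (h : 2 ^ k ≤ t) : cutTime t k + 2 ^ k ≤ t := by
  have h1 := Nat.div_add_mod t (2 ^ k)
  have h3 : cutTime t k = 2 ^ k * (t / 2 ^ k) - 2 ^ k := by
    rw [cutTime, Nat.mul_sub, mul_one]
  have h4 : 2 ^ k * 1 ≤ 2 ^ k * (t / 2 ^ k) :=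
    Nat.mul_le_mul_left _ ((Nat.one_le_div_iff (Nat.two_pow_pos k)).mpr h)
  omega

/-- There is no cut strictly between `cutTime t (k + 1)` and `cutTime t k`. -/
theorem cutTime_consecutive {t k : ℕ} (h : 2 ^ k ≤ t) (T : ℕ) (hT : IsCut t T) :
    ¬ (cutTime t (k + 1) < T ∧ T < cutTime t k) := by
  rintro ⟨h1, h2⟩
  obtain ⟨-, j, ⟨c, rfl⟩, h3⟩ := hT
  have h4 := cutTime_add_le h
  have hkj : k < j + 1 := (Nat.pow_lt_pow_iff_right (a := 2) (by norm_num)).mp (by omega)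
  rcases Nat.eq_or_lt_of_le (Nat.le_of_lt_succ hkj) with rfl | hlt
  · have h5 : c < t / 2 ^ k - 1 := Nat.lt_of_mul_lt_mul_left h2
    have h6 : 2 ^ k * (c + 2) ≤ 2 ^ k * (t / 2 ^ k) := Nat.mul_le_mul_left _ (by omega)
    have h7 := Nat.mul_div_le t (2 ^ k)
    rw [mul_add] at h6
    rw [pow_succ] at h3
    omega
  · obtain ⟨i, rfl⟩ := Nat.exists_eq_add_of_lt hlt
    have h5 : 2 ^ (k + i + 1) * c = 2 ^ (k + 1) * (2 ^ i * c) := by ring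
    rw [h5] at h1 h2
    have h6 : t / 2 ^ (k + 1) - 1 < 2 ^ i * c := Nat.lt_of_mul_lt_mul_left h1
    have h7 : t / 2 ^ (k + 1) = t / 2 ^ k / 2 := by rw [pow_succ, Nat.div_div_eq_div_mul]
    have h8 : 2 ^ (k + 1) * (2 ^ i * c) = 2 ^ k * (2 * (2 ^ i * c)) := by ring
    rw [h8] at h2
    have h9 : 2 * (2 ^ i * c) < t / 2 ^ k - 1 := Nat.lt_of_mul_lt_mul_left h2
    omega

/-! ### Sampling one item per block -/

/-- The length of the block that contains the time `t`: the largest power of two that is at most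
`t / 2 ^ m`, and `1` if `t < 2 ^ m`. -/
def blk (m t : ℕ) : ℕ := 2 ^ (Nat.log 2 t - m)

/-- The beginning of the block that contains the time `t`. -/
def blockStart (m t : ℕ) : ℕ := t - t % blk m t

/-- With the offsets `h` drawn at the beginnings of the blocks, the item `t` is sampled. -/
def Sampled (m : ℕ) (h : ℕ → ℕ) (t : ℕ) : Prop := t % blk m t = h (blockStart m t)

instance (m : ℕ) (h : ℕ → ℕ) : DecidablePred (Sampled m h) := fun _ => Nat.decEq _ _

/-- The sampled positions before time `t`. -/
def sampleSet (m : ℕ) (h : ℕ → ℕ) (t : ℕ) : Finset ℕ := {q ∈ Finset.range t | Sampled m h q}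

theorem blk_pos (m t : ℕ) : 0 < blk m t := Nat.two_pow_pos _

theorem blk_mono (m : ℕ) : Monotone (blk m) := fun _ _ h =>
  Nat.pow_le_pow_right (by norm_num) (Nat.sub_le_sub_right (Nat.log_mono_right h) _)

theorem blk_le {m t : ℕ} (ht : t ≠ 0) : blk m t ≤ t :=
  (Nat.pow_le_pow_right (by norm_num) (Nat.sub_le _ _)).trans (Nat.pow_log_le_self 2 ht)

theorem two_pow_mul_blk_le {m t : ℕ} (h : 2 ^ m ≤ t) : 2 ^ m * blk m t ≤ t := by
  have ht : t ≠ 0 := ((Nat.two_pow_pos m).trans_le h).ne'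
  have hm : m ≤ Nat.log 2 t := (Nat.le_log_iff_pow_le (by norm_num) ht).mpr h
  rw [blk, ← pow_add, Nat.add_sub_cancel' hm]
  exact Nat.pow_log_le_self 2 ht

/-- Either `t` and `t + 1` belong to the same block, or a block ends at `t`. -/
theorem block_step (m t : ℕ) :
    (blockStart m (t + 1) = blockStart m t ∧ blk m (t + 1) = blk m t ∧
      (t + 1) % blk m (t + 1) = t % blk m t + 1) ∨
    (blockStart m (t + 1) = t + 1 ∧ t % blk m t + 1 = blk m t ∧
      (t + 1) % blk m (t + 1) = 0) := by
  have hB := blk_pos m t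
  have hmod := Nat.mod_lt t hB
  have hsame : blk m (t + 1) = blk m t → (blockStart m (t + 1) = blockStart m t ∧
      blk m (t + 1) = blk m t ∧ (t + 1) % blk m (t + 1) = t % blk m t + 1) ∨
    (blockStart m (t + 1) = t + 1 ∧ t % blk m t + 1 = blk m t ∧
      (t + 1) % blk m (t + 1) = 0) := by
    intro hb
    unfold blockStart
    rw [hb]
    have hd := Nat.div_add_mod t (blk m t)
    by_cases hc : t % blk m t + 1 = blk m t
    · right
      have : (t + 1) % blk m t = 0 := by
        by_cases h1 : blk m t = 1
        · rw [h1, Nat.mod_one]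
        · have : 1 % blk m t = 1 := Nat.mod_eq_of_lt (by omega)
          rw [Nat.add_mod, this, hc, Nat.mod_self]
      omega
    · left
      have : (t + 1) % blk m t = t % blk m t + 1 := by
        rw [Nat.add_mod, Nat.mod_eq_of_lt (show 1 < blk m t by omega),
          Nat.mod_eq_of_lt (by omega)]
      omega
  by_cases hlog : Nat.log 2 (t + 1) = Nat.log 2 t
  · exact hsame (by rw [blk, blk, hlog])
  · right
    have h0 : t ≠ 0 := by
      rintro rfl
      simp at hlog
    have h1 : Nat.log 2 t < Nat.log 2 (t + 1) :=
      lt_of_le_of_ne (Nat.log_mono_right (Nat.le_succ t)) (Ne.symm hlog)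
    have h2 : t < 2 ^ (Nat.log 2 t + 1) := Nat.lt_pow_succ_log_self (by norm_num) t
    have h3 : 2 ^ (Nat.log 2 t + 1) ≤ t + 1 := Nat.pow_le_of_le_log (by omega) h1
    have h4 : t + 1 = 2 ^ (Nat.log 2 t + 1) := by omega
    have h5 : (t + 1) % blk m (t + 1) = 0 := by
      refine Nat.mod_eq_zero_of_dvd ?_
      rw [blk, h4, Nat.log_pow (by norm_num)]
      exact pow_dvd_pow _ (Nat.sub_le _ _)
    have h6 : blk m t ∣ t + 1 := by
      rw [blk, h4]
      exact pow_dvd_pow _ (by omega)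
    refine ⟨by rw [blockStart, h5, Nat.sub_zero], ?_, h5⟩
    have h7 : blk m t ∣ t % blk m t + 1 := by
      rw [Nat.dvd_iff_mod_eq_zero, Nat.mod_add_mod]
      exact Nat.mod_eq_zero_of_dvd h6
    exact le_antisymm (by omega) (Nat.le_of_dvd (by omega) h7)

theorem blk_blockStart (m t : ℕ) : blk m (blockStart m t) = blk m t := by
  induction t with
  | zero => simp [blockStart]
  | succ t ih =>
    rcases block_step m t with ⟨h1, h2, -⟩ | ⟨h1, -, -⟩
    · rw [h1, h2, ih]
    · rw [h1]

/-- The weight of the sampled items is that of the finished blocks, and of the current block if its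
sample has arrived. -/
theorem sum_sampleSet {m t : ℕ} {h : ℕ → ℕ} (hh : ∀ s < t, h s < blk m s) :
    ∑ q ∈ sampleSet m h t, blk m q =
      blockStart m t + if h (blockStart m t) < t % blk m t then blk m t else 0 := by
  induction t with
  | zero => simp [sampleSet, blockStart]
  | succ t ih =>
    have ih' := ih fun s hs => hh s (Nat.lt_succ_of_lt hs)
    have hmod := Nat.mod_lt t (blk_pos m t)
    have hle := Nat.mod_le t (blk m t)
    have hstep : ∑ q ∈ sampleSet m h (t + 1), blk m q = ∑ q ∈ sampleSet m h t, blk m q +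
        if t % blk m t = h (blockStart m t) then blk m t else 0 := by
      unfold sampleSet
      rw [Finset.sum_filter, Finset.sum_range_succ, Finset.sum_filter]
      rfl
    have hb := blk_blockStart m t
    have hs : h (blockStart m t) < blk m t := by
      rw [← hb]
      exact hh _ (by unfold blockStart; omega)
    rw [hstep, ih']
    rcases block_step m t with ⟨h1, h2, h3⟩ | ⟨h1, h2, h3⟩
    · rw [h2] at h3
      rw [h1, h2, h3]
      split_ifs <;> omega
    · rw [h3, h1]
      have : blockStart m t + blk m t = t + 1 := by unfold blockStart; omega
      split_ifs <;> omega

theorem sum_sampleSet_le {m t : ℕ} {h : ℕ → ℕ} (hh : ∀ s < t, h s < blk m s) :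
    ∑ q ∈ sampleSet m h t, blk m q ≤ t + blk m t := by
  rw [sum_sampleSet hh]
  have : blockStart m t ≤ t := Nat.sub_le _ _
  split_ifs <;> omega

theorem lt_sum_sampleSet_add {m t : ℕ} {h : ℕ → ℕ} (hh : ∀ s < t, h s < blk m s) :
    t < ∑ q ∈ sampleSet m h t, blk m q + blk m t := by
  rw [sum_sampleSet hh]
  have := Nat.mod_lt t (blk_pos m t)
  have : blockStart m t = t - t % blk m t := rfl
  omega

theorem sum_sampleSet_since_le {m t T : ℕ} {h : ℕ → ℕ} (hT : T ≤ t)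
    (hh : ∀ s < t, h s < blk m s) :
    ∑ q ∈ sampleSet m h t with T ≤ q, blk m q + T ≤ t + 2 * blk m t := by
  have h1 := lt_sum_sampleSet_add (m := m) (t := T) (h := h) fun s hs => hh s (by omega)
  have h2 := sum_sampleSet_le hh
  have h3 := blk_mono m hT
  have h4 : ∑ q ∈ sampleSet m h T, blk m q + ∑ q ∈ sampleSet m h t with T ≤ q, blk m q ≤
      ∑ q ∈ sampleSet m h t, blk m q := by
    rw [← Finset.sum_union]
    · refine Finset.sum_le_sum_of_subset fun q hq => ?_
      simp only [sampleSet, Finset.mem_union, Finset.mem_filter, Finset.mem_range] at hq ⊢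
      rcases hq with hq | hq
      · exact ⟨by omega, hq.2⟩
      · exact hq.1
    · rw [Finset.disjoint_left]
      intro q hq hq'
      simp only [sampleSet, Finset.mem_filter, Finset.mem_range] at hq hq'
      omega
  omega

/-- The tolerated weight of a gap at time `t`. -/
def tol (δ : ℝ) (t : ℕ) : ℕ := ⌊δ * t⌋₊

theorem tol_mono {δ : ℝ} (hδ : 0 ≤ δ) : Monotone (tol δ) := fun _ _ h =>
  Nat.floor_mono (mul_le_mul_of_nonneg_left (Nat.cast_le.mpr h) hδ)

theorem le_tol_sub {δ : ℝ} (hδ : 0 ≤ δ) {s t : ℕ} (h : s ≤ t) :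
    δ * ((t : ℝ) - s) ≤ ((tol δ t + 1 - tol δ s : ℕ) : ℝ) := by
  have h1 := tol_mono hδ h
  rw [Nat.cast_sub (by omega)]
  have h2 : δ * t < (tol δ t : ℝ) + 1 := Nat.lt_floor_add_one _
  have h3 : (tol δ s : ℝ) ≤ δ * s := Nat.floor_le (by positivity)
  push_cast
  linarith

/-! ### Space -/

section space

variable {α : Type*} [LinearOrder α] {m t W : ℕ} {δ : ℝ} {h : ℕ → ℕ} {y : ℕ → α} {L : List Node}

/-- The recently arrived nodes are few, since each of them has about the weight of a block. -/
theorem Inv.countP_recent_le (hI : Inv (blk m) (tol δ) y t (sampleSet m h t) W L)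
    (hm : 2 ≤ m) (hh : ∀ s < t, h s < blk m s) :
    L.countP (fun z => decide (cutTime t (Nat.log 2 t - m) ≤ z.b)) ≤ 8 := by
  set T := cutTime t (Nat.log 2 t - m) with hT
  have h1 := lt_cutTime_add t (Nat.log 2 t - m)
  rw [← hT, pow_succ] at h1
  change t < T + blk m t * 2 at h1
  have h2 := sum_sampleSet_since_le (m := m) (isCut_cutTime t (Nat.log 2 t - m)).1 hh
  rw [← hT] at h2
  have h3 : ∀ q ∈ {q ∈ sampleSet m h t | T ≤ q}, blk m t ≤ 2 * blk m q := by
    intro q hq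
    simp only [sampleSet, Finset.mem_filter, Finset.mem_range] at hq
    have hpow : blk m t = 2 ^ (Nat.log 2 t - m) := rfl
    unfold blk
    rw [← pow_succ']
    refine Nat.pow_le_pow_right (by norm_num) ?_
    by_cases he : Nat.log 2 t ≤ m
    · omega
    have h4 : Nat.log 2 t - 1 ≤ Nat.log 2 q := by
      refine Nat.le_log_of_pow_le (by norm_num) ?_
      have h5 : 2 ^ Nat.log 2 t ≤ t := Nat.pow_log_le_self 2 (by omega)
      have h6 : 2 ^ Nat.log 2 t = 2 ^ (Nat.log 2 t - 1) * 2 := by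
        rw [← pow_succ]
        congr 1
        omega
      have h7 : 2 ^ (Nat.log 2 t - m) * 2 ≤ 2 ^ (Nat.log 2 t - 1) := by
        rw [← pow_succ]
        exact Nat.pow_le_pow_right (by norm_num) (by omega)
      omega
    omega
  have h4 : L.countP (fun z => decide (T ≤ z.b)) ≤ ({q ∈ sampleSet m h t | T ≤ q}).card := by
    rw [List.countP_eq_length_filter, ← List.length_map (f := Node.b)]
    have hnd : ((L.filter fun z => decide (T ≤ z.b)).map Node.b).Nodup := by
      refine List.Pairwise.map _ (fun a b hab => ?_)
        (hI.sorted.sublist List.filter_sublist)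
      rintro hab'
      rw [hab'] at hab
      exact lt_irrefl _ hab
    rw [← List.toFinset_card_of_nodup hnd]
    refine Finset.card_le_card fun q hq => ?_
    simp only [List.mem_toFinset, List.mem_map, List.mem_filter, decide_eq_true_eq] at hq
    obtain ⟨z, hz, rfl⟩ := hq
    exact Finset.mem_filter.mpr ⟨hI.sub z hz.1, hz.2⟩
  refine h4.trans ?_
  have h5 := Finset.card_nsmul_le_sum _ (fun q => 2 * blk m q) (blk m t) h3
  rw [← Finset.mul_sum, smul_eq_mul] at h5
  have h6 : ({q ∈ sampleSet m h t | T ≤ q}).card * blk m t ≤ 8 * blk m t := by omega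
  exact Nat.le_of_mul_le_mul_right h6 (blk_pos m t)

/-- A summary that admits no drop has `O(m / δ)` nodes: `O(1 / δ)` for each of the at most `m` age
classes that are older than a block. -/
theorem Inv.length_le (hI : Inv (blk m) (tol δ) y t (sampleSet m h t) W L)
    (hs : ∀ L', ¬ Drop (blk m) (tol δ) t W L L')
    (hm : 2 ≤ m) (hδ : 0 < δ) (hh : ∀ s < t, h s < blk m s) :
    (L.length : ℝ) ≤ 8 + m * (24 / δ) := by
  have hlen0 : L.countP (fun z => decide (cutTime t (Nat.log 2 t) ≤ z.b)) = L.length := by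
    have h0 : cutTime t (Nat.log 2 t) = 0 := by
      have : t / 2 ^ Nat.log 2 t < 2 := by
        rw [Nat.div_lt_iff_lt_mul (Nat.two_pow_pos _), ← pow_succ']
        exact Nat.lt_pow_succ_log_self (by norm_num) t
      rw [cutTime, show t / 2 ^ Nat.log 2 t - 1 = 0 by omega, mul_zero]
    simp [h0]
  rcases Nat.eq_zero_or_pos t with rfl | ht
  · have : L = [] := by
      rcases L with _ | ⟨z, L⟩
      · rfl
      · exact absurd (hI.lt _ (hI.sub z (by simp))) (by omega)
    subst this
    simp only [List.length_nil, Nat.cast_zero]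
    positivity
  set k₀ := Nat.log 2 t - m with hk₀
  have hband : ∀ k, k₀ ≤ k → k < Nat.log 2 t →
      (bandCount (cutTime t (k + 1)) (cutTime t k) L : ℝ) ≤ 24 / δ := by
    intro k hk1 hk2
    have hkt : 2 ^ k ≤ t := Nat.pow_le_of_le_log ht.ne' hk2.le
    have hcut := cutTime_add_le hkt
    have h1 := hI.bandCount_mul_le (tol_mono hδ.le) hs (isCut_cutTime t (k + 1))
      (isCut_cutTime t k).1 (cutTime_consecutive hkt)
    have h2 := sum_sampleSet_since_le (m := m) (isCut_cutTime t (k + 1)).1 hh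
    have h3 := lt_cutTime_add t (k + 1)
    have h4 : blk m t ≤ 2 ^ k := Nat.pow_le_pow_right (by norm_num) hk1
    have h5 : 2 ^ (k + 1 + 1) = 4 * 2 ^ k := by ring
    have h6 := le_tol_sub hδ.le (isCut_cutTime t k).1
    have h7 : bandCount (cutTime t (k + 1)) (cutTime t k) L *
        (tol δ t + 1 - tol δ (cutTime t k)) ≤ 24 * 2 ^ k := by omega
    have h8 : (bandCount (cutTime t (k + 1)) (cutTime t k) L : ℝ) *
        ((tol δ t + 1 - tol δ (cutTime t k) : ℕ) : ℝ) ≤ 24 * 2 ^ k := by exact_mod_cast h7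
    have h9 : δ * 2 ^ k ≤ ((tol δ t + 1 - tol δ (cutTime t k) : ℕ) : ℝ) := by
      refine le_trans (mul_le_mul_of_nonneg_left ?_ hδ.le) h6
      have : ((cutTime t k + 2 ^ k : ℕ) : ℝ) ≤ t := by exact_mod_cast hcut
      push_cast at this
      linarith
    rw [le_div_iff₀ hδ]
    have h10 : (0 : ℝ) < 2 ^ k := by positivity
    have h11 := (mul_le_mul_of_nonneg_left h9 (Nat.cast_nonneg
      (bandCount (cutTime t (k + 1)) (cutTime t k) L))).trans h8
    rw [← mul_assoc] at h11
    exact le_of_mul_le_mul_right h11 h10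
  have hsum : ∀ i, k₀ + i ≤ Nat.log 2 t →
      (L.countP (fun z => decide (cutTime t (k₀ + i) ≤ z.b)) : ℝ) ≤ 8 + i * (24 / δ) := by
    intro i
    induction i with
    | zero =>
      intro _
      have := hI.countP_recent_le hm hh
      simpa using (by exact_mod_cast this :
        (L.countP (fun z => decide (cutTime t k₀ ≤ z.b)) : ℝ) ≤ 8)
    | succ i ih =>
      intro hi
      have h1 := ih (by omega)
      have h2 := hband (k₀ + i) (by omega) (by omega)
      have h3 : L.countP (fun z => decide (cutTime t (k₀ + (i + 1)) ≤ z.b)) ≤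
          L.countP (fun z => decide (cutTime t (k₀ + i) ≤ z.b)) +
            bandCount (cutTime t (k₀ + i + 1)) (cutTime t (k₀ + i)) L := by
        rw [← add_assoc]
        unfold bandCount
        clear * -
        induction L with
        | nil => simp
        | cons z L ih =>
          simp only [List.countP_cons, decide_eq_true_eq]
          split_ifs <;> omega
      have h4 : (L.countP (fun z => decide (cutTime t (k₀ + (i + 1)) ≤ z.b)) : ℝ) ≤
          L.countP (fun z => decide (cutTime t (k₀ + i) ≤ z.b)) +
            bandCount (cutTime t (k₀ + i + 1)) (cutTime t (k₀ + i)) L := by exact_mod_cast h3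
      push_cast
      linarith
  have h1 := hsum (Nat.log 2 t - k₀) (by omega)
  rw [show k₀ + (Nat.log 2 t - k₀) = Nat.log 2 t by omega, hlen0] at h1
  have h2 : ((Nat.log 2 t - k₀ : ℕ) : ℝ) ≤ m := by exact_mod_cast (by omega)
  have h3 : (0 : ℝ) < 24 / δ := by positivity
  nlinarith

end space

/-! ### Concentration of the sampled weight -/

theorem tsum_bind_mul {β γ : Type*} (p : PMF β) (g : β → PMF γ) (f : γ → ENNReal) :
    ∑' b, (p.bind g) b * f b = ∑' a, p a * ∑' b, g a b * f b := by
  simp only [PMF.bind_apply, ← ENNReal.tsum_mul_right, ← ENNReal.tsum_mul_left]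
  rw [ENNReal.tsum_comm]
  simp only [mul_assoc]

theorem tsum_pure_mul {β : Type*} (a : β) (f : β → ENNReal) :
    ∑' b, (PMF.pure a) b * f b = f a := by
  rw [tsum_eq_single a fun b hb => by simp [PMF.pure_apply, hb]]
  simp

theorem tsum_map_mul {β γ : Type*} (p : PMF β) (g : β → γ) (f : γ → ENNReal) :
    ∑' b, (p.map g) b * f b = ∑' a, p a * f (g a) := by
  unfold PMF.map
  rw [tsum_bind_mul]
  simp only [Function.comp_apply, tsum_pure_mul]

/-- The distribution of the offset that is drawn at time `s`: uniform on a block. -/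
def drawPMF (m s : ℕ) : PMF ℕ :=
  PMF.uniformOfFinset (Finset.range (blk m s)) (Finset.nonempty_range_iff.mpr (blk_pos m s).ne')

/-- The distribution of the offsets that are drawn before time `t`. An offset is drawn at every
time; those drawn inside a block are ignored later. -/
def hist (m : ℕ) : ℕ → PMF (ℕ → ℕ)
  | 0 => PMF.pure fun _ => 0
  | t + 1 => (hist m t).bind fun h => (drawPMF m t).map fun d => Function.update h t d

theorem lt_blk_of_mem_support {m t : ℕ} {h : ℕ → ℕ} (hh : h ∈ (hist m t).support) :
    ∀ s < t, h s < blk m s := by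
  induction t generalizing h with
  | zero => intro s hs; omega
  | succ t ih =>
    simp only [hist, PMF.mem_support_bind_iff, PMF.mem_support_map_iff] at hh
    obtain ⟨h', hh', d, hd, rfl⟩ := hh
    intro s hs
    by_cases hst : s = t
    · subst hst
      simpa [drawPMF, PMF.mem_support_uniformOfFinset_iff] using hd
    · rw [Function.update_of_ne hst]
      exact ih hh' s (by omega)

theorem tsum_drawPMF_mul (m s : ℕ) (f : ℕ → ENNReal) :
    ∑' d, drawPMF m s d * f d = (∑ d ∈ Finset.range (blk m s), f d) * (blk m s : ENNReal)⁻¹ := by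
  rw [tsum_eq_sum (s := Finset.range (blk m s)), Finset.sum_mul]
  · refine Finset.sum_congr rfl fun d hd => ?_
    rw [drawPMF, PMF.uniformOfFinset_apply_of_mem _ hd, Finset.card_range, mul_comm]
  · intro d hd
    rw [drawPMF, PMF.uniformOfFinset_apply_of_notMem _ hd, zero_mul]

/-- The exponential moment of a sum of functions of the independent offsets. -/
theorem tsum_hist_mul_exp_le {m : ℕ} (φ : ℕ → ℕ → ℝ) (c : ℕ → ℝ) (t : ℕ)
    (hφ : ∀ s < t, ∑ d ∈ Finset.range (blk m s), Real.exp (φ s d) ≤ blk m s * Real.exp (c s)) :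
    ∑' h, hist m t h * ENNReal.ofReal (Real.exp (∑ s ∈ Finset.range t, φ s (h s))) ≤
      ENNReal.ofReal (Real.exp (∑ s ∈ Finset.range t, c s)) := by
  induction t with
  | zero =>
    simp only [hist, Finset.range_zero, Finset.sum_empty]
    rw [tsum_pure_mul]
  | succ t ih =>
    have hstep : ∀ h : ℕ → ℕ, ∑' d, drawPMF m t d * ENNReal.ofReal (Real.exp
        (∑ s ∈ Finset.range (t + 1), φ s (Function.update h t d s))) ≤
        ENNReal.ofReal (Real.exp (∑ s ∈ Finset.range t, φ s (h s))) *
          ENNReal.ofReal (Real.exp (c t)) := by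
      intro h
      have h1 : ∀ d, ENNReal.ofReal (Real.exp
          (∑ s ∈ Finset.range (t + 1), φ s (Function.update h t d s))) =
          ENNReal.ofReal (Real.exp (∑ s ∈ Finset.range t, φ s (h s))) *
            ENNReal.ofReal (Real.exp (φ t d)) := by
        intro d
        have h2 : ∑ s ∈ Finset.range t, φ s (Function.update h t d s) =
            ∑ s ∈ Finset.range t, φ s (h s) := Finset.sum_congr rfl fun s hs => by
          rw [Function.update_of_ne (Finset.mem_range.mp hs).ne]
        rw [Finset.sum_range_succ, Function.update_self, Real.exp_add,
          ENNReal.ofReal_mul (Real.exp_nonneg _), h2]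
      simp only [h1]
      rw [tsum_drawPMF_mul, ← Finset.mul_sum, mul_assoc,
        ← ENNReal.ofReal_sum_of_nonneg fun _ _ => Real.exp_nonneg _]
      refine mul_le_mul_right ?_ _
      rw [← div_eq_mul_inv]
      refine ENNReal.div_le_of_le_mul ?_
      rw [← ENNReal.ofReal_natCast, ← ENNReal.ofReal_mul (Real.exp_nonneg _), mul_comm]
      exact ENNReal.ofReal_le_ofReal (hφ t (Nat.lt_succ_self t))
    rw [hist, tsum_bind_mul]
    simp only [tsum_map_mul]
    calc _ ≤ ∑' h, hist m t h * (ENNReal.ofReal (Real.exp (∑ s ∈ Finset.range t, φ s (h s))) *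
          ENNReal.ofReal (Real.exp (c t))) :=
          ENNReal.tsum_le_tsum fun h => mul_le_mul_right (hstep h) _
      _ = (∑' h, hist m t h * ENNReal.ofReal (Real.exp (∑ s ∈ Finset.range t, φ s (h s)))) *
          ENNReal.ofReal (Real.exp (c t)) := by
          rw [← ENNReal.tsum_mul_right]
          simp only [mul_assoc]
      _ ≤ ENNReal.ofReal (Real.exp (∑ s ∈ Finset.range t, c s)) *
          ENNReal.ofReal (Real.exp (c t)) :=
          mul_le_mul_left (ih fun s hs => hφ s (Nat.lt_succ_of_lt hs)) _
      _ = _ := by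
          rw [← ENNReal.ofReal_mul (Real.exp_nonneg _), ← Real.exp_add, Finset.sum_range_succ]

/-- The exponential moment of the error that one block causes for a set of `card A` items of the
block, when one of the `B` items of the block is chosen with weight `B`. -/
theorem sum_exp_block_le {B : ℕ} (hB : 0 < B) {A : Finset ℕ} (hA : A ⊆ Finset.range B) {l : ℝ}
    (hl : |l| * B ≤ 1) :
    ∑ d ∈ Finset.range B, Real.exp (l * ((if d ∈ A then (B : ℝ) else 0) - A.card)) ≤
      B * Real.exp (l ^ 2 * B * A.card) := by
  have hcard : (A.card : ℝ) ≤ B := by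
    exact_mod_cast (Finset.card_le_card hA).trans_eq (Finset.card_range B)
  have hB0 : (0 : ℝ) ≤ B := Nat.cast_nonneg B
  have hA0 : (0 : ℝ) ≤ A.card := Nat.cast_nonneg _
  have h1 : ∀ d ∈ Finset.range B,
      Real.exp (l * ((if d ∈ A then (B : ℝ) else 0) - A.card)) ≤
        (1 - l * A.card + l ^ 2 * A.card ^ 2) +
          (if d ∈ A then l * B + l ^ 2 * (B ^ 2 - 2 * B * A.card) else 0) := by
    intro d _
    have h2 : |(if d ∈ A then (B : ℝ) else 0) - A.card| ≤ B := by
      rw [abs_le]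
      split_ifs <;> constructor <;> linarith
    have h3 : |l * ((if d ∈ A then (B : ℝ) else 0) - A.card)| ≤ 1 := by
      rw [abs_mul]
      exact (mul_le_mul_of_nonneg_left h2 (abs_nonneg l)).trans hl
    -- `exp u ≤ 1 + u + u ^ 2` for `|u| ≤ 1`, and the linear terms will cancel in the sum
    have h4 := (abs_le.mp (Real.abs_exp_sub_one_sub_id_le h3)).2
    split_ifs at h4 ⊢ <;> nlinarith
  refine (Finset.sum_le_sum h1).trans ?_
  rw [Finset.sum_add_distrib, Finset.sum_const, Finset.card_range, nsmul_eq_mul,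
    Finset.sum_ite_mem, Finset.inter_eq_right.mpr hA, Finset.sum_const, nsmul_eq_mul]
  have h5 : l ^ 2 * B * A.card + 1 ≤ Real.exp (l ^ 2 * B * A.card) := Real.add_one_le_exp _
  have h6 := mul_le_mul_of_nonneg_left h5 hB0
  have h7 : 0 ≤ l ^ 2 * (B * A.card ^ 2) := by positivity
  nlinarith

/-- The error of the sampled weight of a set `A` of positions of the stream. -/
def sampleError (m : ℕ) (A : Finset ℕ) (h : ℕ → ℕ) : ℝ :=
  ∑ q ∈ A, ((if Sampled m h q then (blk m q : ℝ) else 0) - 1)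

/-- Chernoff bound for the sampled weight of a fixed set of positions. -/
theorem sampleError_tail {m t : ℕ} {A : Finset ℕ} (hA : A ⊆ Finset.range t) {l : ℝ}
    (hl : |l| * blk m t ≤ 1) (a : ℝ) :
    (hist m t).toOuterMeasure {h | a ≤ l * sampleError m A h} ≤
      ENNReal.ofReal (Real.exp (l ^ 2 * blk m t * A.card - a)) := by
  -- the error is a sum over the blocks; `Ab s` is the part of `A` in the block that begins at `s`
  set Ab : ℕ → Finset ℕ := fun s => {q ∈ A | blockStart m q = s} with hAb
  have hmem : ∀ s, ∀ q ∈ Ab s, s ≤ q ∧ blk m q = blk m s ∧ q - s < blk m s ∧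
      q % blk m q = q - s ∧ blockStart m q = s := by
    intro s q hq
    obtain ⟨-, rfl⟩ := Finset.mem_filter.mp hq
    have h1 := Nat.mod_lt q (blk_pos m q)
    have h2 := Nat.mod_le q (blk m q)
    rw [blk_blockStart]
    unfold blockStart
    omega
  set φ : ℕ → ℕ → ℝ := fun s d =>
    l * ((if d ∈ (Ab s).image (· - s) then (blk m s : ℝ) else 0) - ((Ab s).image (· - s)).card)
    with hφ
  have hinj : ∀ s, Set.InjOn (fun q => q - s) (Ab s : Set ℕ) := by
    intro s q hq q' hq' hqq
    have h1 := (hmem s q hq).1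
    have h2 := (hmem s q' hq').1
    simp only at hqq
    omega
  have hsum : ∀ h, ∑ s ∈ Finset.range t, φ s (h s) = l * sampleError m A h := by
    intro h
    rw [sampleError, ← Finset.sum_fiberwise_of_maps_to (s := A) (t := Finset.range t)
      (g := blockStart m), Finset.mul_sum]
    · refine Finset.sum_congr rfl fun s _ => ?_
      simp only [hφ]
      congr 1
      rw [Finset.sum_sub_distrib, Finset.card_image_of_injOn (hinj s), Finset.sum_const,
        nsmul_eq_mul, mul_one]
      congr 1
      change _ = ∑ q ∈ Ab s, _
      have h1 : ∀ q ∈ Ab s, (if Sampled m h q then (blk m q : ℝ) else 0) =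
          if q - s = h s then (blk m s : ℝ) else 0 := by
        intro q hq
        obtain ⟨-, h2, -, h3, h4⟩ := hmem s q hq
        exact if_congr (by unfold Sampled; rw [h3, h4]) (by rw [h2]) rfl
      rw [Finset.sum_congr rfl h1,
        ← Finset.sum_image (f := fun d => if d = h s then (blk m s : ℝ) else 0) (hinj s),
        Finset.sum_ite_eq']
    · intro q hq
      have := Finset.mem_range.mp (hA hq)
      exact Finset.mem_range.mpr (lt_of_le_of_lt (Nat.sub_le _ _) this)
  have hmgf := tsum_hist_mul_exp_le (m := m) φ (fun s => l ^ 2 * blk m t * (Ab s).card) t (by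
    intro s hs
    have hst : (blk m s : ℝ) ≤ blk m t := by exact_mod_cast blk_mono m hs.le
    refine (sum_exp_block_le (blk_pos m s) ?_ ?_).trans ?_
    · intro d hd
      obtain ⟨q, hq, rfl⟩ := Finset.mem_image.mp hd
      exact Finset.mem_range.mpr (hmem s q hq).2.2.1
    · exact (mul_le_mul_of_nonneg_left hst (abs_nonneg l)).trans hl
    · rw [Finset.card_image_of_injOn (hinj s)]
      gcongr)
  rw [← Finset.mul_sum, ← Nat.cast_sum, ← Finset.card_eq_sum_card_fiberwise (by
    intro q hq
    have := Finset.mem_range.mp (hA hq)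
    exact Finset.mem_coe.mpr
      (Finset.mem_range.mpr (lt_of_le_of_lt (Nat.sub_le _ _) this)))] at hmgf
  simp only [hsum] at hmgf
  rw [PMF.toOuterMeasure_apply, sub_eq_add_neg, Real.exp_add,
    ENNReal.ofReal_mul (Real.exp_nonneg _)]
  refine le_trans ?_ (mul_le_mul_left hmgf _)
  rw [← ENNReal.tsum_mul_right]
  refine ENNReal.tsum_le_tsum fun h => ?_
  by_cases hh : a ≤ l * sampleError m A h
  · rw [Set.indicator_of_mem (show h ∈ {h | a ≤ l * sampleError m A h} from hh), mul_assoc,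
      ← ENNReal.ofReal_mul (Real.exp_nonneg _), ← Real.exp_add]
    refine le_mul_of_one_le_right' ?_
    rw [ENNReal.one_le_ofReal]
    exact Real.one_le_exp (by linarith)
  · rw [Set.indicator_of_notMem (show h ∉ {h | a ≤ l * sampleError m A h} from hh)]
    exact bot_le

/-! ### The algorithm -/

/-- The integers that the algorithm stores: the time, the current offset, the total sampled weight
and the nodes. -/
structure State where
  t : ℕ
  off : ℕ
  W : ℕ
  L : List Node

/-- The integer words that hold a list of nodes. -/
def encodeNodes (L : List Node) : List ℕ := L.flatMap fun v => [v.b, v.lo, v.hi]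

/-- The list of nodes that is held by a list of integer words. -/
def decodeNodes : List ℕ → List Node
  | b :: lo :: hi :: r => ⟨b, lo, hi⟩ :: decodeNodes r
  | _ => []

/-- The integer words that hold a state. -/
def encode (σ : State) : List ℕ := σ.t :: σ.off :: σ.W :: encodeNodes σ.L

/-- The state that is held by a list of integer words. -/
def decode : List ℕ → State
  | t :: off :: W :: r => ⟨t, off, W, decodeNodes r⟩
  | _ => ⟨0, 0, 0, []⟩

theorem decodeNodes_encodeNodes (L : List Node) : decodeNodes (encodeNodes L) = L := by
  induction L with
  | nil => rfl
  | cons v L ih =>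
    change decodeNodes (v.b :: v.lo :: v.hi :: encodeNodes L) = _
    rw [decodeNodes, ih]

theorem decode_encode (σ : State) : decode (encode σ) = σ := by
  rw [encode, decode, decodeNodes_encodeNodes]

theorem length_encodeNodes (L : List Node) : (encodeNodes L).length = 3 * L.length := by
  induction L with
  | nil => rfl
  | cons v L ih =>
    change (v.b :: v.lo :: v.hi :: encodeNodes L).length = _
    simp only [List.length_cons, ih]
    omega

/-- The state after the arrival of an item, where `P` tells which of the stored items are at most
the new one, and `d` is the offset that is drawn. -/
def next (m : ℕ) (δ : ℝ) (P : Node → Bool) (d : ℕ) (σ : State) : State :=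
  let off := if σ.t % blk m σ.t = 0 then d else σ.off
  if σ.t % blk m σ.t = off then
    ⟨σ.t + 1, off, σ.W + blk m σ.t,
      reduce (blk m) (tol δ) (σ.t + 1) (σ.W + blk m σ.t)
        (insertNode (blk m) σ.t σ.W (σ.L.filter P) (σ.L.filter fun v => !P v))⟩
  else ⟨σ.t + 1, off, σ.W, reduce (blk m) (tol δ) (σ.t + 1) σ.W σ.L⟩

theorem next_congr {m : ℕ} {δ : ℝ} {P P' : Node → Bool} {d : ℕ} {σ : State}
    (h : ∀ v ∈ σ.L, P v = P' v) : next m δ P d σ = next m δ P' d σ := by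
  have h1 : σ.L.filter P = σ.L.filter P' := List.filter_congr h
  have h2 : (σ.L.filter fun v => !P v) = σ.L.filter fun v => !P' v :=
    List.filter_congr fun v hv => by rw [h v hv]
  rw [next, next, h1, h2]

theorem next_births {m : ℕ} {δ : ℝ} {P : Node → Bool} {d : ℕ} {σ : State} :
    ∀ v ∈ (next m δ P d σ).L, v.b ∈ σ.L.map Node.b ++ [σ.t] := by
  intro v hv
  unfold next at hv
  generalize (if σ.t % blk m σ.t = 0 then d else σ.off) = off at hv
  dsimp only at hv
  split_ifs at hv
  all_goals
    replace hv := (reduce_sublist _ _ _ _ _).subset hv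
    simp only [insertNode, List.mem_append, List.mem_cons, List.mem_map, List.mem_filter,
      List.not_mem_nil, or_false] at hv ⊢
  · rcases hv with hv | rfl | ⟨v, hv, rfl⟩
    · exact .inl ⟨v, hv.1, rfl⟩
    · exact .inr rfl
    · exact .inl ⟨v, hv.1, rfl⟩
  · exact .inl ⟨v, hv, rfl⟩

/-- The entry of a comparison table, extended by `false`. -/
def cmpAt (n : ℕ) (cmp : Fin n → Fin n → Bool) (i j : ℕ) : Bool :=
  if h : i < n ∧ j < n then cmp ⟨i, h.1⟩ ⟨j, h.2⟩ else false

/-- The position of the item `b` among the stored items followed by the new one. -/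
def itemIdx (σ : State) (b : ℕ) : ℕ := (σ.L.map Node.b ++ [σ.t]).idxOf b

/-- The rank `k` to which a query for the real rank `ρ` is rounded. It exists for all queries that
have to be answered; otherwise the value is `0`. -/
def roundRank (ε : ℝ) (t : ℕ) (ρ : ℝ) : ℕ :=
  open Classical in
  if h : ∃ k : ℕ, 1 ≤ k ∧ k ≤ t ∧ |(k : ℝ) - ρ| ≤ ε * t ∧ |(k : ℝ) - ρ| ≤ 1 then h.choose else 0

/-- The answer to a query: the position of a stored item that is good for the rounded rank.
The minimum with `W` matters since the sampled weight may fall short of the time by a block. -/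
def pick (m : ℕ) (ε : ℝ) (σ : State) (n : ℕ) (ρ : ℝ) : Option (Fin n) :=
  open Classical in
  if h : ∃ i : Fin n, ∃ v, σ.L[(i : ℕ)]? = some v ∧
      Good (blk m) (tol (ε / 4)) σ.t (min (roundRank ε σ.t ρ) σ.W) v
  then some h.choose else none

/-- The streaming algorithm with blocks of relative length `2 ^ (-m)` and tolerance `ε / 4`. -/
def algorithm (m : ℕ) (ε : ℝ) : ComparisonSummary where
  init := encode ⟨0, 0, 0, []⟩
  update mem n cmp :=
    let σ := decode mem
    (drawPMF m σ.t).map fun d =>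
      let σ' := next m (ε / 4) (fun v => cmpAt n cmp (itemIdx σ v.b) (n - 1)) d σ
      (σ'.L.filterMap fun v => if h : itemIdx σ v.b < n then some ⟨itemIdx σ v.b, h⟩ else none,
        encode σ')
  query mem n _ ρ := pick m ε (decode mem) n ρ

/-- The configuration that belongs to a state. -/
def config {D : Type*} (x : ℕ → D) (σ : State) : Config D := ⟨σ.L.map fun v => x v.b, encode σ⟩

theorem get_itemIdx {D : Type*} (x : ℕ → D) (σ : State) {b : ℕ} (hb : b ∈ σ.L.map Node.b ++ [σ.t])
    (h : itemIdx σ b < ((σ.L.map fun v => x v.b) ++ [x σ.t]).length) :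
    ((σ.L.map fun v => x v.b) ++ [x σ.t]).get ⟨itemIdx σ b, h⟩ = x b := by
  have h1 : (σ.L.map fun v => x v.b) ++ [x σ.t] = (σ.L.map Node.b ++ [σ.t]).map x := by simp
  simp only [List.get_eq_getElem, h1, List.getElem_map]
  congr 1
  exact List.getElem_idxOf (List.idxOf_lt_length_of_mem hb)

theorem itemIdx_lt {D : Type*} (x : ℕ → D) (σ : State) {b : ℕ} (hb : b ∈ σ.L.map Node.b ++ [σ.t]) :
    itemIdx σ b < ((σ.L.map fun v => x v.b) ++ [x σ.t]).length := by
  have := List.idxOf_lt_length_of_mem hb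
  simpa [itemIdx] using this

/-- The stream with ties broken by the time of arrival. -/
def keyed {D : Type*} (x : ℕ → D) (q : ℕ) : D ×ₗ ℕ := toLex (x q, q)

theorem keyed_injective {D : Type*} (x : ℕ → D) : Function.Injective (keyed x) := fun _ _ h =>
  congrArg (fun p => (ofLex p).2) h

section run

variable {D : Type*} [LinearOrder D] (x : ℕ → D) (m : ℕ) (ε : ℝ)

/-- The state at time `t` if the offsets `h` are drawn. -/
def stateAt (h : ℕ → ℕ) : ℕ → State
  | 0 => ⟨0, 0, 0, []⟩
  | t + 1 => next m (ε / 4) (fun v => decide (x v.b ≤ x t)) (h t) (stateAt h t)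

theorem stateAt_t (h : ℕ → ℕ) (t : ℕ) : (stateAt x m ε h t).t = t := by
  induction t with
  | zero => rfl
  | succ t ih =>
    rw [stateAt, next]
    split_ifs <;> simp [ih]

theorem stateAt_congr {h h' : ℕ → ℕ} {t : ℕ} (hh : ∀ s < t, h s = h' s) :
    stateAt x m ε h t = stateAt x m ε h' t := by
  induction t with
  | zero => rfl
  | succ t ih => rw [stateAt, stateAt, ih fun s hs => hh s (by omega), hh t (by omega)]

theorem step_config (σ : State) :
    (algorithm m ε).step (config x σ) (x σ.t) = (drawPMF m σ.t).map fun d =>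
      config x (next m (ε / 4) (fun v => decide (x v.b ≤ x σ.t)) d σ) := by
  unfold ComparisonSummary.step
  simp only [algorithm, config, decode_encode, PMF.map_comp]
  congr 1
  funext d
  have hP : next m (ε / 4) (fun v => cmpAt ((σ.L.map fun v => x v.b) ++ [x σ.t]).length
      (comparisons ((σ.L.map fun v => x v.b) ++ [x σ.t])) (itemIdx σ v.b)
      (((σ.L.map fun v => x v.b) ++ [x σ.t]).length - 1)) d σ =
      next m (ε / 4) (fun v => decide (x v.b ≤ x σ.t)) d σ := by
    refine next_congr fun v hv => ?_
    have hb : v.b ∈ σ.L.map Node.b ++ [σ.t] :=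
      List.mem_append_left _ (List.mem_map_of_mem hv)
    have h1 := itemIdx_lt x σ hb
    have h2 : ((σ.L.map fun v => x v.b) ++ [x σ.t]).length - 1 <
        ((σ.L.map fun v => x v.b) ++ [x σ.t]).length := by simp
    rw [cmpAt, dif_pos ⟨h1, h2⟩, comparisons, get_itemIdx x σ hb]
    congr 2
    simp
  simp only [Function.comp_apply, hP, Config.mk.injEq, and_true, List.map_filterMap]
  conv_rhs => rw [← List.filterMap_eq_map]
  refine List.filterMap_congr fun v hv => ?_
  have hb := next_births v hv
  rw [dif_pos (itemIdx_lt x σ hb), Option.map_some, get_itemIdx x σ hb]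
  rfl

theorem run_eq (t : ℕ) :
    (algorithm m ε).run x t = (hist m t).map fun h => config x (stateAt x m ε h t) := by
  induction t with
  | zero =>
    rw [ComparisonSummary.run, hist, PMF.pure_map]
    rfl
  | succ t ih =>
    rw [ComparisonSummary.run, ih, hist, PMF.bind_map, PMF.map_bind]
    congr 1
    funext h
    have hs := step_config x m ε (stateAt x m ε h t)
    rw [stateAt_t] at hs
    rw [Function.comp_apply, hs, PMF.map_comp]
    congr 1
    funext d
    rw [Function.comp_apply, stateAt, Function.update_self,
      stateAt_congr x m ε (h := Function.update h t d) (h' := h) fun s hs =>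
        Function.update_of_ne hs.ne _ _]

theorem keyed_lt {a b : ℕ} : keyed x a < keyed x b ↔ x a < x b ∨ x a = x b ∧ a < b :=
  Prod.Lex.toLex_lt_toLex

theorem stateAt_off (h : ℕ → ℕ) (t : ℕ) :
    (stateAt x m ε h (t + 1)).off = h (blockStart m t) := by
  have hoff : ∀ t, (stateAt x m ε h (t + 1)).off =
      if t % blk m t = 0 then h t else (stateAt x m ε h t).off := by
    intro t
    rw [stateAt, next]
    simp only [stateAt_t]
    split_ifs <;> rfl
  induction t with
  | zero =>
    rw [hoff]
    simp [blockStart]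
  | succ t ih =>
    rw [hoff]
    split_ifs with h0
    · rw [blockStart, h0, Nat.sub_zero]
    · rw [ih]
      rcases block_step m t with ⟨h1, -⟩ | ⟨-, -, h1⟩
      · rw [h1]
      · exact absurd h1 h0

theorem filter_append_filter_not {r : Node → Node → Prop} {P : Node → Bool} {L : List Node}
    (hL : L.Pairwise r) (hP : ∀ a ∈ L, ∀ b ∈ L, r a b → P b = true → P a = true) :
    L.filter P ++ (L.filter fun v => !P v) = L := by
  induction L with
  | nil => rfl
  | cons a L ih =>
    rw [List.pairwise_cons] at hL
    have ih' := ih hL.2 fun u hu v hv => hP u (by simp [hu]) v (by simp [hv])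
    by_cases ha : P a = true
    · simp [ha, ih']
    · have h1 : ∀ b ∈ L, P b = false := fun b hb => by
        by_contra hb'
        exact ha (hP a (by simp) b (by simp [hb]) (hL.1 b hb) (by simpa using hb'))
      have h2 : L.filter P = [] := List.filter_eq_nil_iff.mpr fun b hb => by simp [h1 b hb]
      have h3 : (L.filter fun v => !P v) = L :=
        List.filter_eq_self.mpr fun b hb => by simp [h1 b hb]
      simp [ha, h2, h3]

variable {ε}

theorem stateAt_inv (hε : 0 ≤ ε) (h : ℕ → ℕ) (t : ℕ) :
    Inv (blk m) (tol (ε / 4)) (keyed x) t (sampleSet m h t) (stateAt x m ε h t).W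
      (stateAt x m ε h t).L := by
  have hE : Monotone (tol (ε / 4)) := tol_mono (by positivity)
  induction t with
  | zero =>
    have : sampleSet m h 0 = ∅ := by simp [sampleSet]
    rw [this]
    exact inv_zero
  | succ t ih =>
    have hoff := stateAt_off x m ε h t
    rw [stateAt, next] at hoff ⊢
    simp only [stateAt_t] at hoff ⊢
    set σ := stateAt x m ε h t
    have hoff' : (if t % blk m t = 0 then h t else σ.off) = h (blockStart m t) := by
      rw [← hoff]
      split_ifs <;> rfl
    rw [hoff']
    by_cases hs : t % blk m t = h (blockStart m t)
    · have hset : sampleSet m h (t + 1) = insert t (sampleSet m h t) := by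
        rw [sampleSet, Finset.range_add_one, Finset.filter_insert, if_pos (by exact hs)]
        rfl
      rw [if_pos hs, hset]
      refine Inv.reduce ?_
      have hlt : ∀ v ∈ σ.L, v.b < t := fun v hv => ih.lt _ (ih.sub v hv)
      have hsplit := filter_append_filter_not (P := fun v => decide (x v.b ≤ x t)) ih.sorted (by
        intro a _ b _ hab hb
        simp only [decide_eq_true_eq] at hb ⊢
        rcases (keyed_lt x).mp hab with hab | hab
        · exact hab.le.trans hb
        · exact hab.1.le.trans hb)
      refine Inv.insert hE (by rwa [hsplit]) ?_ ?_
      · intro v hv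
        simp only [List.mem_filter, decide_eq_true_eq] at hv
        rcases hv.2.lt_or_eq with h1 | h1
        · exact (keyed_lt x).mpr (.inl h1)
        · exact (keyed_lt x).mpr (.inr ⟨h1, hlt v hv.1⟩)
      · intro v hv
        simp only [List.mem_filter, Bool.not_eq_true', decide_eq_false_iff_not, not_le] at hv
        exact (keyed_lt x).mpr (.inl hv.2)
    · have hset : sampleSet m h (t + 1) = sampleSet m h t := by
        rw [sampleSet, Finset.range_add_one, Finset.filter_insert, if_neg (by exact hs)]
        rfl
      rw [if_neg hs, hset]
      exact (ih.tick hE).reduce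

theorem stateAt_stuck (h : ℕ → ℕ) (t : ℕ) (L' : List Node) :
    ¬ Drop (blk m) (tol (ε / 4)) t (stateAt x m ε h t).W (stateAt x m ε h t).L L' := by
  rcases t with _ | t
  · rintro ⟨pre, mid, post, hm, hL, -⟩
    obtain ⟨-, h2⟩ := List.append_eq_nil_iff.mp hL.symm
    exact hm (List.append_eq_nil_iff.mp h2).1
  · rw [stateAt, next]
    simp only [stateAt_t]
    split_ifs <;> exact reduce_stuck _ _ _ _ _ _

/-- Every integer word is polynomial in the time. -/
theorem mem_encode_le (hε : 0 ≤ ε) (hε1 : ε ≤ 1) {h : ℕ → ℕ} {t : ℕ}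
    (hh : ∀ s < t, h s < blk m s) :
    ∀ n ∈ encode (stateAt x m ε h t), n ≤ (t + 2) ^ 2 := by
  have hI := stateAt_inv x m hε h t
  have hblk : blk m t ≤ t + 1 := by
    rcases Nat.eq_zero_or_pos t with rfl | ht
    · simp [blk]
    · exact (blk_le ht.ne').trans (Nat.le_succ t)
  have hW := sum_sampleSet_le hh
  rw [← hI.total] at hW
  have hsq : 3 * t + 2 ≤ (t + 2) ^ 2 := by nlinarith
  intro n hn
  simp only [encode, encodeNodes, List.mem_cons, List.mem_flatMap, List.not_mem_nil,
    or_false] at hn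
  rcases hn with rfl | rfl | rfl | ⟨v, hv, hn⟩
  · rw [stateAt_t]
    omega
  · rcases t with _ | t
    · simp [stateAt]
    · rw [stateAt_off]
      have h1 := hh (blockStart m t) (Nat.lt_succ_of_le (Nat.sub_le _ _))
      have h2 := blk_mono m (show blockStart m t ≤ t + 1 from
        (Nat.sub_le _ _).trans (Nat.le_succ t))
      omega
  · omega
  · have hb := hI.lt _ (hI.sub v hv)
    have hlo : v.lo ≤ (stateAt x m ε h t).W := by
      rw [hI.total]
      exact (hI.rank_lo v hv).trans (below_le_total _ _)
    have hhi := hI.delta v hv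
    have hE : tol (ε / 4) v.b ≤ v.b := by
      refine Nat.floor_le_of_le ?_
      have : (0 : ℝ) ≤ v.b := Nat.cast_nonneg _
      nlinarith
    rcases hn with rfl | rfl | rfl <;> omega

theorem exists_answer (h : ℕ → ℕ) (t : ℕ) (ρ : ℝ) (hg : ∃ v ∈ (stateAt x m ε h t).L,
      Good (blk m) (tol (ε / 4)) t (min (roundRank ε t ρ) (stateAt x m ε h t).W) v) :
    ∃ v ∈ (stateAt x m ε h t).L,
      Good (blk m) (tol (ε / 4)) t (min (roundRank ε t ρ) (stateAt x m ε h t).W) v ∧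
      (algorithm m ε).answer (config x (stateAt x m ε h t)) ρ = some (x v.b) := by
  have ht := stateAt_t x m ε h t
  set σ := stateAt x m ε h t
  have hex : ∃ i : Fin (config x σ).items.length, ∃ v, σ.L[(i : ℕ)]? = some v ∧
      Good (blk m) (tol (ε / 4)) σ.t (min (roundRank ε σ.t ρ) σ.W) v := by
    obtain ⟨v, hv, hgv⟩ := hg
    obtain ⟨i, hi, rfl⟩ := List.mem_iff_getElem.mp hv
    exact ⟨⟨i, by simpa [config] using hi⟩, σ.L[i], by simp, by rwa [ht]⟩
  obtain ⟨v, hv, hgv⟩ := hex.choose_spec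
  refine ⟨v, List.mem_of_getElem? hv, by rwa [ht] at hgv, ?_⟩
  have hq : (algorithm m ε).query (config x σ).mem (config x σ).items.length
      (comparisons (config x σ).items) ρ = some hex.choose := by
    change pick m ε (decode (encode σ)) _ ρ = _
    rw [decode_encode]
    exact dif_pos hex
  rw [ComparisonSummary.answer, hq, Option.map_some]
  congr 1
  obtain ⟨hi, hv'⟩ := List.getElem?_eq_some_iff.mp hv
  simp only [config, List.get_eq_getElem, List.getElem_map]
  exact congrArg (fun u => x u.b) hv'

end run

/-! ### Accuracy -/

section accuracy

variable {D : Type*} [LinearOrder D] (x : ℕ → D)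

/-- The number of the first `t` items that precede the item `b`, ties being broken by the time of
arrival. -/
def posRank (t b : ℕ) : ℕ := ({i ∈ Finset.range t | keyed x i < keyed x b}).card

theorem card_le_eq_posRank {t b : ℕ} (hb : b < t) :
    ({i ∈ Finset.range t | keyed x i ≤ keyed x b}).card = posRank x t b + 1 := by
  rw [posRank, ← Finset.card_insert_of_notMem (a := b) (by simp)]
  congr 1
  ext i
  simp only [Finset.mem_filter, Finset.mem_range, Finset.mem_insert, le_iff_lt_or_eq,
    (keyed_injective x).eq_iff]
  constructor
  · tauto
  · rintro (rfl | h)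
    · exact ⟨hb, .inr rfl⟩
    · exact ⟨h.1, .inl h.2⟩

theorem posRank_mono {t a b : ℕ} (h : keyed x a ≤ keyed x b) : posRank x t a ≤ posRank x t b := by
  refine Finset.card_le_card fun q hq => ?_
  simp only [Finset.mem_filter] at hq ⊢
  exact ⟨hq.1, hq.2.trans_le h⟩

theorem rankWithin_of_posRank {t b : ℕ} (hb : b < t) {ρ δ : ℝ}
    (h : |(posRank x t b : ℝ) + 1 - ρ| ≤ δ) : RankWithin (x b) x t ρ δ := by
  refine ⟨posRank x t b + 1, ?_, ?_, by push_cast; exact h⟩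
  · refine Nat.lt_succ_of_le (Finset.card_le_card fun i hi => ?_)
    simp only [Finset.mem_filter] at hi ⊢
    exact ⟨hi.1, (keyed_lt x).mpr (.inl hi.2)⟩
  · rw [← card_le_eq_posRank x hb]
    refine Finset.card_le_card fun i hi => ?_
    simp only [Finset.mem_filter] at hi ⊢
    refine ⟨hi.1, ?_⟩
    rcases hi.2.lt_or_eq with h1 | h1
    · rcases (keyed_lt x).mp h1 with h2 | h2
      · exact h2.le
      · exact h2.1.le
    · rw [keyed_injective x h1]

/-- The items whose rank is less than `c`. -/
def lowSet (t : ℕ) (c : ℝ) : Finset ℕ := {i ∈ Finset.range t | (posRank x t i : ℝ) + 1 < c}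

/-- The items whose rank is at most `c`. -/
def notHighSet (t : ℕ) (c : ℝ) : Finset ℕ := {i ∈ Finset.range t | (posRank x t i : ℝ) + 1 ≤ c}

/-- The largest item of the low set has rank at least the size of the set. -/
theorem card_lowSet_lt {t v : ℕ} {c : ℝ} (hv : v ∈ lowSet x t c) :
    ((lowSet x t c).card : ℝ) < c := by
  obtain ⟨u, hu, hmax⟩ := (lowSet x t c).exists_max_image (keyed x) ⟨v, hv⟩
  have hu' := hu
  simp only [lowSet, Finset.mem_filter, Finset.mem_range] at hu'
  have h1 : (lowSet x t c).card ≤ posRank x t u + 1 := by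
    rw [← card_le_eq_posRank x hu'.1]
    refine Finset.card_le_card fun i hi => Finset.mem_filter.mpr ⟨?_, hmax i hi⟩
    exact (Finset.mem_filter.mp hi).1
  have h2 : ((lowSet x t c).card : ℝ) ≤ posRank x t u + 1 := by exact_mod_cast h1
  linarith [hu'.2]

/-- The items before the smallest high item are not high. -/
theorem lt_card_notHighSet {t v : ℕ} {c : ℝ} (hv : v < t) (hc : c < (posRank x t v : ℝ) + 1) :
    c < ((notHighSet x t c).card : ℝ) + 1 := by
  obtain ⟨u, hu, hmin⟩ := ({i ∈ Finset.range t | c < (posRank x t i : ℝ) + 1}).exists_min_image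
    (keyed x) ⟨v, by simp [hv, hc]⟩
  simp only [Finset.mem_filter, Finset.mem_range] at hu hmin
  have h1 : posRank x t u ≤ (notHighSet x t c).card := by
    refine Finset.card_le_card fun i hi => ?_
    simp only [notHighSet, Finset.mem_filter, Finset.mem_range] at hi ⊢
    refine ⟨hi.1, ?_⟩
    by_contra hi'
    exact absurd hi.2 (hmin i ⟨hi.1, not_le.mp hi'⟩).not_gt
  have h2 : (posRank x t u : ℝ) ≤ (notHighSet x t c).card := by exact_mod_cast h1
  linarith [hu.2]

theorem sampleError_eq {m t : ℕ} {h : ℕ → ℕ} {A : Finset ℕ} (hA : A ⊆ Finset.range t) :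
    sampleError m A h = ((∑ q ∈ sampleSet m h t with q ∈ A, blk m q : ℕ) : ℝ) - A.card := by
  rw [sampleError, Finset.sum_sub_distrib, Finset.sum_const, nsmul_eq_mul, mul_one,
    ← Finset.sum_filter, Nat.cast_sum]
  congr 1
  refine Finset.sum_congr ?_ fun _ _ => rfl
  ext q
  simp only [sampleSet, Finset.mem_filter]
  constructor
  · rintro ⟨h1, h2⟩
    exact ⟨⟨hA h1, h2⟩, h1⟩
  · tauto

variable {m t : ℕ} {h : ℕ → ℕ}

/-- If the rank of the sampled item `v` is too small, then the sampled items up to `v` all lie in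
the low set. -/
theorem below_add_le_lowSet {v : ℕ} {c : ℝ} (hv : v ∈ sampleSet m h t) (hvc : v ∈ lowSet x t c) :
    below (blk m) (keyed x) (sampleSet m h t) v + blk m v ≤
      ∑ q ∈ sampleSet m h t with q ∈ lowSet x t c, blk m q := by
  unfold below
  rw [add_comm, ← Finset.sum_insert (f := blk m) (a := v) (by simp)]
  refine Finset.sum_le_sum_of_subset fun q hq => ?_
  simp only [Finset.mem_insert, Finset.mem_filter] at hq ⊢
  rcases hq with rfl | hq
  · exact ⟨hv, hvc⟩
  · refine ⟨hq.1, Finset.mem_filter.mpr ⟨(Finset.mem_filter.mp hq.1).1, ?_⟩⟩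
    have h1 : (posRank x t q : ℝ) ≤ posRank x t v := by exact_mod_cast posRank_mono x hq.2.le
    linarith [(Finset.mem_filter.mp hvc).2]

/-- If the rank of `v` is too large, then all items that are not high precede `v`. -/
theorem notHighSet_le_below {v : ℕ} {c : ℝ} (hc : c < (posRank x t v : ℝ) + 1) :
    ∑ q ∈ sampleSet m h t with q ∈ notHighSet x t c, blk m q ≤
      below (blk m) (keyed x) (sampleSet m h t) v := by
  refine Finset.sum_le_sum_of_subset fun q hq => ?_
  simp only [Finset.mem_filter] at hq ⊢
  refine ⟨hq.1, ?_⟩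
  by_contra hqv
  have h1 : (posRank x t v : ℝ) ≤ posRank x t q := by
    exact_mod_cast posRank_mono x (not_lt.mp hqv)
  linarith [(Finset.mem_filter.mp hq.2).2]

/-- As long as the blocks have length one, every item is sampled. -/
theorem sampleSet_eq_range (hh : ∀ s < t, h s < blk m s) (hb : blk m t = 1) :
    sampleSet m h t = Finset.range t ∧ ∀ q ∈ Finset.range t, blk m q = 1 := by
  have h1 : ∀ q ∈ Finset.range t, blk m q = 1 := fun q hq => by
    have := blk_mono m (Finset.mem_range.mp hq).le
    have := blk_pos m q
    omega
  refine ⟨Finset.filter_true_of_mem fun q hq => ?_, h1⟩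
  have h2 := hh q (Finset.mem_range.mp hq)
  unfold Sampled blockStart
  rw [h1 q hq] at h2 ⊢
  rw [Nat.mod_one, Nat.sub_zero]
  omega

theorem below_eq_posRank (hh : ∀ s < t, h s < blk m s) (hb : blk m t = 1) (v : ℕ) :
    below (blk m) (keyed x) (sampleSet m h t) v = posRank x t v := by
  obtain ⟨h1, h2⟩ := sampleSet_eq_range hh hb
  rw [below, h1, posRank, Finset.card_eq_sum_ones]
  exact Finset.sum_congr rfl fun q hq => h2 q (Finset.mem_filter.mp hq).1

variable {ε ρ : ℝ}

theorem roundRank_spec (hρ : 0 < ρ) (hρt : ρ ≤ t)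
    (hk : ∃ k : ℕ, 1 ≤ k ∧ k ≤ t ∧ |(k : ℝ) - ρ| ≤ ε * t) :
    1 ≤ roundRank ε t ρ ∧ roundRank ε t ρ ≤ t ∧ |(roundRank ε t ρ : ℝ) - ρ| ≤ ε * t ∧
      |(roundRank ε t ρ : ℝ) - ρ| ≤ 1 := by
  have hex : ∃ k : ℕ, 1 ≤ k ∧ k ≤ t ∧ |(k : ℝ) - ρ| ≤ ε * t ∧ |(k : ℝ) - ρ| ≤ 1 := by
    obtain ⟨k, h1, h2, h3⟩ := hk
    by_cases h4 : |(k : ℝ) - ρ| ≤ 1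
    · exact ⟨k, h1, h2, h3, h4⟩
    · have h5 : |(⌈ρ⌉₊ : ℝ) - ρ| ≤ 1 := by
        have := Nat.le_ceil ρ
        have := Nat.ceil_lt_add_one hρ.le
        rw [abs_le]
        constructor <;> linarith
      exact ⟨⌈ρ⌉₊, Nat.one_le_ceil_iff.mpr hρ, Nat.ceil_le.mpr hρt, by linarith, h5⟩
  rw [roundRank, dif_pos hex]
  exact hex.choose_spec

/-- Every query is answered by a node whose bounds are close to the query rank. -/
theorem exists_good_answer (hε : 0 < ε) (hε2 : ε ≤ 1 / 2) (hm : 2 ≤ m) (ht : 0 < t)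
    (hh : ∀ s < t, h s < blk m s) {ρ : ℝ} (hk1 : 1 ≤ roundRank ε t ρ) :
    ∃ v ∈ (stateAt x m ε h t).L,
      Good (blk m) (tol (ε / 4)) t (min (roundRank ε t ρ) (stateAt x m ε h t).W) v ∧
      (algorithm m ε).answer (config x (stateAt x m ε h t)) ρ = some (x v.b) := by
  have hI := stateAt_inv x m hε.le h t
  have hW := lt_sum_sampleSet_add hh
  rw [← hI.total] at hW
  have hEW : tol (ε / 4) t < (stateAt x m ε h t).W := by
    have h1 : tol (ε / 4) t * 8 ≤ t := by
      have h2 : ((tol (ε / 4) t : ℕ) : ℝ) ≤ ε / 4 * t := Nat.floor_le (by positivity)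
      have h3 : (0 : ℝ) ≤ t := Nat.cast_nonneg t
      have h4 : ((tol (ε / 4) t * 8 : ℕ) : ℝ) ≤ t := by push_cast; nlinarith
      exact_mod_cast h4
    by_cases h2 : 2 ^ m ≤ t
    · have h3 := two_pow_mul_blk_le h2
      have h4 : 2 ^ 2 * blk m t ≤ 2 ^ m * blk m t :=
        Nat.mul_le_mul_right _ (Nat.pow_le_pow_right (by norm_num) hm)
      omega
    · have h3 : blk m t = 1 := by
        have : Nat.log 2 t < m := Nat.log_lt_of_lt_pow ht.ne' (not_le.mp h2)
        rw [blk, Nat.sub_eq_zero_of_le this.le, pow_zero]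
      omega
  exact exists_answer x m h t ρ (hI.exists_good (tol_mono (by positivity))
    (le_min hk1 (by omega)) (min_le_right _ _) hEW (blk_pos m))

/-- While the blocks have length one, the answers are correct with certainty. -/
theorem rankWithin_of_blk_eq_one (hε : 0 < ε) (hh : ∀ s < t, h s < blk m s) (hb : blk m t = 1)
    (hk : |(roundRank ε t ρ : ℝ) - ρ| ≤ ε * t ∧ |(roundRank ε t ρ : ℝ) - ρ| ≤ 1)
    (hkt : roundRank ε t ρ ≤ t) {v : Node} (hv : v ∈ (stateAt x m ε h t).L)
    (hg : Good (blk m) (tol (ε / 4)) t (min (roundRank ε t ρ) (stateAt x m ε h t).W) v) :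
    RankWithin (x v.b) x t ρ (ε * t) := by
  have hI := stateAt_inv x m hε.le h t
  have hW := lt_sum_sampleSet_add hh
  rw [← hI.total, hb] at hW
  have hvt : v.b < t := hI.lt _ (hI.sub v hv)
  have h1 := hI.rank_lo v hv
  have h2 := hI.rank_hi v hv
  rw [below_eq_posRank x hh hb] at h1 h2
  have hbv : blk m v.b = 1 := (sampleSet_eq_range hh hb).2 _ (Finset.mem_range.mpr hvt)
  rw [min_eq_left (by omega), Good, hbv] at hg
  refine rankWithin_of_posRank x hvt ?_
  have h3 : roundRank ε t ρ ≤ posRank x t v.b + 1 + tol (ε / 4) t := by omega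
  have h4 : posRank x t v.b + 1 ≤ roundRank ε t ρ + tol (ε / 4) t := by omega
  rcases Nat.eq_zero_or_pos (tol (ε / 4) t) with h5 | h5
  · have h6 : posRank x t v.b + 1 = roundRank ε t ρ := by omega
    have h7 : (posRank x t v.b : ℝ) + 1 = roundRank ε t ρ := by exact_mod_cast h6
    rw [h7]
    exact hk.1
  · have h6 : ((tol (ε / 4) t : ℕ) : ℝ) ≤ ε / 4 * t := Nat.floor_le (by positivity)
    have h7 : (1 : ℝ) ≤ tol (ε / 4) t := by exact_mod_cast h5
    have h8 : (roundRank ε t ρ : ℝ) ≤ posRank x t v.b + 1 + tol (ε / 4) t := by exact_mod_cast h3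
    have h9 : (posRank x t v.b : ℝ) + 1 ≤ roundRank ε t ρ + tol (ε / 4) t := by exact_mod_cast h4
    have h10 := abs_le.mp hk.2
    rw [abs_le]
    constructor <;> linarith [h10.1, h10.2]

/-- A wrong answer reveals a large sampling error for one of two sets of positions that do not
depend on the random choices. -/
theorem rankWithin_or_sampleError (hε : 0 < ε) (hh : ∀ s < t, h s < blk m s)
    (hlarge : (1 : ℝ) + blk m t ≤ ε * t / 4)
    (hk : |(roundRank ε t ρ : ℝ) - ρ| ≤ 1)
    (hkt : roundRank ε t ρ ≤ t) {v : Node} (hv : v ∈ (stateAt x m ε h t).L)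
    (hg : Good (blk m) (tol (ε / 4)) t (min (roundRank ε t ρ) (stateAt x m ε h t).W) v) :
    RankWithin (x v.b) x t ρ (ε * t) ∨
      ε * t / 2 ≤ sampleError m (lowSet x t (ρ - ε * t)) h ∨
      sampleError m (notHighSet x t (ρ + ε * t)) h ≤ -(ε * t / 2) := by
  have hI := stateAt_inv x m hε.le h t
  have hW := lt_sum_sampleSet_add hh
  rw [← hI.total] at hW
  have hvS := hI.sub v hv
  have hvt : v.b < t := hI.lt _ hvS
  have h1 := hI.rank_lo v hv
  have h2 := hI.rank_hi v hv
  have htol : ((tol (ε / 4) t : ℕ) : ℝ) ≤ ε / 4 * t := Nat.floor_le (by positivity)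
  have hk' := abs_le.mp hk
  have hblk : (1 : ℝ) ≤ blk m t := by exact_mod_cast blk_pos m t
  obtain ⟨hg1, hg2⟩ := hg
  by_cases hlow : (posRank x t v.b : ℝ) + 1 < ρ - ε * t
  · right; left
    have hvl : v.b ∈ lowSet x t (ρ - ε * t) :=
      Finset.mem_filter.mpr ⟨Finset.mem_range.mpr hvt, hlow⟩
    rw [sampleError_eq (t := t) (A := lowSet x t _) (Finset.filter_subset _ _)]
    have h3 := card_lowSet_lt x hvl
    have h4 := below_add_le_lowSet x hvS hvl
    have h5 : roundRank ε t ρ ≤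
        ∑ q ∈ sampleSet m h t with q ∈ lowSet x t (ρ - ε * t), blk m q + tol (ε / 4) t +
          blk m t := by
      rcases le_total (roundRank ε t ρ) (stateAt x m ε h t).W with h6 | h6
      · rw [min_eq_left h6] at hg1
        omega
      · rw [min_eq_right h6] at hg1
        omega
    have h6 : (roundRank ε t ρ : ℝ) ≤
        ((∑ q ∈ sampleSet m h t with q ∈ lowSet x t (ρ - ε * t), blk m q : ℕ) : ℝ) +
          tol (ε / 4) t + blk m t := by exact_mod_cast h5
    linarith [hk'.1, hk'.2]
  by_cases hhigh : ρ + ε * t < (posRank x t v.b : ℝ) + 1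
  · right; right
    rw [sampleError_eq (t := t) (A := notHighSet x t _) (Finset.filter_subset _ _)]
    have h3 := lt_card_notHighSet x hvt hhigh
    have h4 := notHighSet_le_below (m := m) (h := h) x hhigh
    have h5 : ∑ q ∈ sampleSet m h t with q ∈ notHighSet x t (ρ + ε * t), blk m q ≤
        roundRank ε t ρ + tol (ε / 4) t := by
      have := min_le_left (roundRank ε t ρ) (stateAt x m ε h t).W
      omega
    have h6 : ((∑ q ∈ sampleSet m h t with q ∈ notHighSet x t (ρ + ε * t), blk m q : ℕ) : ℝ) ≤
        roundRank ε t ρ + tol (ε / 4) t := by exact_mod_cast h5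
    linarith [hk'.1, hk'.2]
  · left
    refine rankWithin_of_posRank x hvt (abs_le.mpr ?_)
    constructor <;> linarith

/-- The Chernoff bound with the exponent `ε / (8 B)`, where `B` is the current block length. -/
theorem sampleError_tail_le (hε : 0 < ε) (hε2 : ε ≤ 1 / 2) (hm64 : 64 / ε ^ 3 ≤ 2 ^ m)
    (hmt : 2 ^ m ≤ t) {A : Finset ℕ} (hA : A ⊆ Finset.range t) {s : ℝ} (hs : |s| = 1) :
    (hist m t).toOuterMeasure {h | ε * t / 2 ≤ s * sampleError m A h} ≤
      ENNReal.ofReal (Real.exp (-(3 / ε))) := by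
  have hB : (0 : ℝ) < blk m t := by exact_mod_cast blk_pos m t
  have hBt : (2 : ℝ) ^ m * blk m t ≤ t := by exact_mod_cast two_pow_mul_blk_le hmt
  have hcard : (A.card : ℝ) ≤ t := by
    exact_mod_cast (Finset.card_le_card hA).trans_eq (Finset.card_range t)
  set B : ℝ := ((blk m t : ℕ) : ℝ)
  set l : ℝ := ε / (8 * B) with hl
  have hlpos : 0 < l := by positivity
  have hs2 : s ^ 2 = 1 := by rw [← sq_abs, hs, one_pow]
  have hset : {h | ε * t / 2 ≤ s * sampleError m A h} ⊆
      {h | l * (ε * t / 2) ≤ (l * s) * sampleError m A h} := by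
    intro h hh
    simp only [Set.mem_ofPred_eq] at hh ⊢
    rw [mul_assoc]
    exact mul_le_mul_of_nonneg_left hh hlpos.le
  have hlB : l * B = ε / 8 := by
    rw [hl]
    field_simp
  refine ((hist m t).toOuterMeasure.mono hset).trans ((sampleError_tail hA (l := l * s) ?_ _).trans
    (ENNReal.ofReal_le_ofReal (Real.exp_le_exp.mpr ?_)))
  · rw [abs_mul, hs, mul_one, abs_of_pos hlpos, hlB]
    linarith
  · have h1 : (l * s) ^ 2 * B * A.card ≤ l * (ε / 8) * t := by
      rw [mul_pow, hs2, mul_one, sq, mul_assoc l l, hlB]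
      exact mul_le_mul_of_nonneg_left hcard (by positivity)
    -- `l * ε * t = ε² t / (8 B) ≥ ε² 2 ^ m / 8 ≥ 8 / ε`
    have h2 : 8 / ε ≤ l * ε * t := by
      rw [hl, div_mul_eq_mul_div, div_mul_eq_mul_div, div_le_div_iff₀ hε (by positivity)]
      have h3 : 64 ≤ ε ^ 3 * 2 ^ m := by
        rwa [div_le_iff₀ (by positivity), mul_comm] at hm64
      calc 8 * (8 * B) = 64 * B := by ring
        _ ≤ ε ^ 3 * 2 ^ m * B := mul_le_mul_of_nonneg_right h3 hB.le
        _ = ε ^ 3 * (2 ^ m * B) := by ring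
        _ ≤ ε ^ 3 * t := mul_le_mul_of_nonneg_left hBt (by positivity)
        _ = ε * ε * t * ε := by ring
    have h3 : 3 / ε = 3 / 8 * (8 / ε) := by ring
    rw [h3]
    linarith

/-- The accuracy guarantee. While all blocks have length one, no answer is wrong; afterwards a wrong
answer requires a large sampling error for one of two fixed sets. -/
theorem successProb_ge (hε : 0 < ε) (hε2 : ε ≤ 1 / 2) (hm : 2 ≤ m) (hm64 : 64 / ε ^ 3 ≤ 2 ^ m)
    (hρ : 0 < ρ) (hρt : ρ ≤ t) (hk : ∃ k : ℕ, 1 ≤ k ∧ k ≤ t ∧ |(k : ℝ) - ρ| ≤ ε * t) :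
    ENNReal.ofReal (1 - Real.exp (-(1 / ε))) ≤ successProb (algorithm m ε) x t ρ (ε * t) := by
  have ht : 0 < t := by
    obtain ⟨k, h1, h2, -⟩ := hk
    omega
  obtain ⟨hk1, hkt, hk2, hk3⟩ := roundRank_spec hρ hρt hk
  rw [successProb, run_eq, PMF.toOuterMeasure_map_apply]
  set G : Set (ℕ → ℕ) := (fun h => config x (stateAt x m ε h t)) ⁻¹'
    {c | ∃ y, (algorithm m ε).answer c ρ = some y ∧ RankWithin y x t ρ (ε * t)} with hG
  by_cases hb : blk m t = 1
  · have h1 : (hist m t).toOuterMeasure G = 1 := by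
      rw [PMF.toOuterMeasure_apply_eq_one_iff]
      intro h hsup
      have hh := lt_blk_of_mem_support hsup
      obtain ⟨v, hv, hg, ha⟩ := exists_good_answer x hε hε2 hm ht hh hk1
      exact ⟨x v.b, ha, rankWithin_of_blk_eq_one x hε hh hb ⟨hk2, hk3⟩ hkt hv hg⟩
    rw [h1, ENNReal.ofReal_le_one]
    linarith [Real.exp_pos (-(1 / ε))]
  have hmt : 2 ^ m ≤ t := by
    by_contra hlt
    have : Nat.log 2 t < m := Nat.log_lt_of_lt_pow ht.ne' (not_le.mp hlt)
    exact hb (by rw [blk, Nat.sub_eq_zero_of_le this.le, pow_zero])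
  have hlarge : (1 : ℝ) + blk m t ≤ ε * t / 4 := by
    have hBt : (2 : ℝ) ^ m * blk m t ≤ t := by exact_mod_cast two_pow_mul_blk_le hmt
    have hB : (1 : ℝ) ≤ blk m t := by exact_mod_cast blk_pos m t
    have h3 : 64 ≤ ε ^ 3 * 2 ^ m := by
      rwa [div_le_iff₀ (by positivity), mul_comm] at hm64
    have h4 : ε ^ 3 * 2 ^ m ≤ ε * 2 ^ m := by
      refine mul_le_mul_of_nonneg_right ?_ (by positivity)
      nlinarith [mul_pos hε hε]
    have h5 : 64 * (blk m t : ℝ) ≤ ε * t := calc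
      64 * (blk m t : ℝ) ≤ ε * 2 ^ m * blk m t :=
        mul_le_mul_of_nonneg_right (h3.trans h4) (by linarith)
      _ = ε * (2 ^ m * blk m t) := by ring
      _ ≤ ε * t := mul_le_mul_of_nonneg_left hBt hε.le
    linarith
  set F₁ : Set (ℕ → ℕ) := {h | ε * t / 2 ≤ 1 * sampleError m (lowSet x t (ρ - ε * t)) h}
  set F₂ : Set (ℕ → ℕ) := {h | ε * t / 2 ≤ (-1) * sampleError m (notHighSet x t (ρ + ε * t)) h}
  have hcover : (hist m t).toOuterMeasure (G ∪ (F₁ ∪ F₂)) = 1 := by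
    rw [PMF.toOuterMeasure_apply_eq_one_iff]
    intro h hsup
    have hh := lt_blk_of_mem_support hsup
    obtain ⟨v, hv, hg, ha⟩ := exists_good_answer x hε hε2 hm ht hh hk1
    rcases rankWithin_or_sampleError x hε hh hlarge hk3 hkt hv hg with h1 | h1 | h1
    · exact .inl ⟨x v.b, ha, h1⟩
    · refine .inr (.inl ?_)
      rw [Set.mem_ofPred_eq]
      linarith
    · refine .inr (.inr ?_)
      rw [Set.mem_ofPred_eq]
      linarith
  have hF₁ := sampleError_tail_le (A := lowSet x t (ρ - ε * t)) hε hε2 hm64 hmt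
    (Finset.filter_subset _ _) (s := 1) (by norm_num)
  have hF₂ := sampleError_tail_le (A := notHighSet x t (ρ + ε * t)) hε hε2 hm64 hmt
    (Finset.filter_subset _ _) (s := -1) (by norm_num)
  have hexp : 2 * Real.exp (-(3 / ε)) ≤ Real.exp (-(1 / ε)) := by
    have h1 : (2 : ℝ) ≤ Real.exp (2 / ε) := by
      have h2 : 2 / ε + 1 ≤ Real.exp (2 / ε) := Real.add_one_le_exp _
      have h3 : 1 ≤ 2 / ε := by
        rw [le_div_iff₀ hε]
        linarith
      linarith
    have h2 : Real.exp (-(1 / ε)) = Real.exp (2 / ε) * Real.exp (-(3 / ε)) := by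
      rw [← Real.exp_add]
      congr 1
      ring
    rw [h2]
    exact mul_le_mul_of_nonneg_right h1 (Real.exp_nonneg _)
  have hsum : (1 : ENNReal) ≤ (hist m t).toOuterMeasure G +
      ENNReal.ofReal (Real.exp (-(1 / ε))) := by
    rw [← hcover]
    refine (MeasureTheory.measure_union_le _ _).trans (add_le_add_right ?_ _)
    refine (MeasureTheory.measure_union_le _ _).trans ((add_le_add hF₁ hF₂).trans ?_)
    rw [← ENNReal.ofReal_add (Real.exp_nonneg _) (Real.exp_nonneg _)]
    exact ENNReal.ofReal_le_ofReal (by linarith)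
  rw [ENNReal.ofReal_sub _ (Real.exp_nonneg _), ENNReal.ofReal_one]
  exact tsub_le_iff_right.mpr hsum

end accuracy

/-! ### The choice of the parameters and the main result -/

/-- The relative block length `2 ^ (-m)` is about `ε ^ 3 / 64`, so that `m` is `O(log (1 / ε))`. -/
theorem exists_block_parameter {ε : ℝ} (hε : 0 < ε) (hε2 : ε ≤ 1 / 2) :
    ∃ m : ℕ, 2 ≤ m ∧ 64 / ε ^ 3 ≤ 2 ^ m ∧ (m : ℝ) ≤ 15 * Real.log (1 / ε) := by
  have hlog2 := Real.log_two_gt_d9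
  have hlog2' := Real.log_two_lt_d9
  have hL : Real.log 2 ≤ Real.log (1 / ε) :=
    Real.log_le_log (by norm_num) (by rw [le_div_iff₀ hε]; linarith)
  set u := (6 * Real.log 2 + 3 * Real.log (1 / ε)) / Real.log 2 with hu
  have hpos : 0 < Real.log 2 := by linarith
  have hu9 : 9 ≤ u := by
    rw [hu, le_div_iff₀ hpos]
    linarith
  refine ⟨⌈u⌉₊, ?_, ?_, ?_⟩
  · have h1 : (9 : ℝ) ≤ ⌈u⌉₊ := hu9.trans (Nat.le_ceil u)
    have h2 : 9 ≤ ⌈u⌉₊ := by exact_mod_cast h1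
    omega
  · have h1 : u * Real.log 2 ≤ ⌈u⌉₊ * Real.log 2 :=
      mul_le_mul_of_nonneg_right (Nat.le_ceil u) hpos.le
    rw [hu, div_mul_cancel₀ _ hpos.ne'] at h1
    rw [← Real.log_le_log_iff (by positivity) (by positivity), Real.log_pow]
    have h2 : Real.log (64 / ε ^ 3) = 6 * Real.log 2 + 3 * Real.log (1 / ε) := by
      rw [show (64 : ℝ) / ε ^ 3 = 2 ^ 6 * (1 / ε) ^ 3 by rw [one_div, inv_pow]; ring,
        Real.log_mul (by positivity) (by positivity), Real.log_pow, Real.log_pow]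
      norm_num
    rw [h2]
    exact h1
  · have h1 := (Nat.ceil_lt_add_one (by linarith : 0 ≤ u)).le
    refine h1.trans ?_
    have h2 : u = 6 + 3 * Real.log (1 / ε) / Real.log 2 := by
      rw [hu, add_div, mul_div_assoc, div_self hpos.ne', mul_one]
    have h3 : 3 * Real.log (1 / ε) / Real.log 2 ≤ 4.33 * Real.log (1 / ε) := by
      rw [div_le_iff₀ hpos]
      nlinarith
    rw [h2]
    linarith

theorem usesSpace_algorithm {D : Type*} [LinearOrder D] (x : ℕ → D) {ε : ℝ} {m : ℕ} (hε : 0 < ε)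
    (hε2 : ε ≤ 1 / 2) (hm : 2 ≤ m) (hm15 : (m : ℝ) ≤ 15 * Real.log (1 / ε)) :
    (algorithm m ε).UsesSpace x (6000 * ((1 / ε) * Real.log (1 / ε))) 2 := by
  intro t c hc
  rw [run_eq, PMF.mem_support_map_iff] at hc
  obtain ⟨h, hsup, rfl⟩ := hc
  have hh := lt_blk_of_mem_support hsup
  refine ⟨?_, mem_encode_le x m hε.le (by linarith) hh⟩
  have hlen := (stateAt_inv x m hε.le h t).length_le (stateAt_stuck x m h t) hm
    (by positivity) hh
  have hwords : (config x (stateAt x m ε h t)).words = 3 + 4 * (stateAt x m ε h t).L.length := by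
    simp only [Config.words, config, encode, List.length_map, List.length_cons,
      length_encodeNodes]
    omega
  rw [hwords]
  push_cast
  have hlog2 := Real.log_two_gt_d9
  have hL : Real.log 2 ≤ Real.log (1 / ε) :=
    Real.log_le_log (by norm_num) (by rw [le_div_iff₀ hε]; linarith)
  have h2 : 2 ≤ 1 / ε := by
    rw [le_div_iff₀ hε]
    linarith
  have h3 : (m : ℝ) * (24 / (ε / 4)) ≤ 1440 * ((1 / ε) * Real.log (1 / ε)) := by
    have h4 : 24 / (ε / 4) = 96 * (1 / ε) := by
      field_simp
      norm_num
    rw [h4]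
    nlinarith
  have h5 : 1.38 ≤ (1 / ε) * Real.log (1 / ε) := by nlinarith
  linarith

end QuantileSummary

end

theorem mainTheorem1 :
    ∃ (C : ℝ) (K : ℕ), ∀ ε : ℝ, 0 < ε → ε ≤ 1 / 2 →
      ∃ A : QuantileSummary.ComparisonSummary,
        ∀ (D : Type*) [LinearOrder D] (x : ℕ → D),
          A.UsesSpace x (C * ((1 / ε) * Real.log (1 / ε))) K ∧
          ∀ (t : ℕ) (ρ : ℝ), 0 < ρ → ρ ≤ t →
            (∃ k : ℕ, 1 ≤ k ∧ k ≤ t ∧ |(k : ℝ) - ρ| ≤ ε * t) →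
            ENNReal.ofReal (1 - Real.exp (-(1 / ε))) ≤
              QuantileSummary.successProb A x t ρ (ε * t) := by
  refine ⟨6000, 2, fun ε hε hε2 => ?_⟩
  obtain ⟨m, hm, hm64, hm15⟩ := QuantileSummary.exists_block_parameter hε hε2
  refine ⟨QuantileSummary.algorithm m ε, fun D _ x => ⟨?_, fun t ρ hρ hρt hk => ?_⟩⟩
  · exact QuantileSummary.usesSpace_algorithm x hε hε2 hm hm15
  · exact QuantileSummary.successProb_ge x hε hε2 hm hm64 hρ hρt hk
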